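/- **Setting.** Let $\|\cdot\|$ and $\|\cdot\|_1$ be the Euclidean and the $\ell_1$ norm on $\mathbb R^n$. Consider $$\min_{x\in\mathbb R^n}\ \frac{\|x\|_1}{\|x\|}\quad\text{s.t.}\quad q(x)\le 0,\qquad q:=P_1-P_2, \tag{P}$$ where $P_1:\mathbb R^n\to\mathbb R$ is continuously differentiable with Lipschitz continuous gradient, $P_2:\mathbb R^n\to\mathbb R$ is convex and continuous, $\{x: q(x)\le 0\}\ne\emptyset$ and $q(0)>0$. For $h:\mathbb R^m\to(-\infty,\infty]$ proper and closed, $\partial h$ is the limiting subdifferential (limits of regular subgradients along $x^k\to x$ with $h(x^k)\to h(x)$; empty outside $\mathrm{dom}\,h$) and $\mathrm{dom}\,\partial h=\{x:\partial h(x)\neq\emptyset\}$. For a locally Lipschitz $f$, $$\partial^\circ f(x)=\Big\{v:\ \limsup_{y\to x,\,s\downarrow 0}\tfrac{f(y+sw)-f(y)}{s}\ge\langle v,w\rangle\ \ \forall w\Big\}$$ is the Clarke subdifferential. $\delta_C$ is the indicator function of $C$ ($0$ on $C$, $\infty$ elsewhere), and $P_2^*(\zeta)=\sup_x\{\langle x,\zeta\rangle-P_2(x)\}$.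 *GMFCQ* holds at $x$ with $q(x)\le0$ if $q(x)=0$ implies $0\notin\partial^\circ q(x)$. A point $\bar x$ with $q(\bar x)\le0$ is *stationary* if $0\in\partial\big(\frac{\|\cdot\|_1}{\|\cdot\|}+\delta_{[q\le0]}\big)(\bar x)$, and *Clarke critical* if there is $\bar\lambda\ge0$ with $0\in\partial\frac{\|\cdot\|_1}{\|\cdot\|}(\bar x)+\bar\lambda\,\partial^\circ q(\bar x)$ and $\bar\lambda q(\bar x)=0$. The function $q$ is *regular* at $x$ if the limiting and the regular normal cones of $\mathrm{epi}\,q$ at $(x,q(x))$ coincide. *KL functions.* A proper closed $h$ has the KL property at $\hat x\in\mathrm{dom}\,\partial h$ if there are $a\in(0,\infty]$, a neighbourhood $U$ of $\hat x$ and a continuous concave $\varphi:[0,a)\to[0,\infty)$ with $\varphi(0)=0$, $\varphi\in C^1(0,a)$, $\varphi'>0$ on $(0,a)$, such that $\varphi'(h(x)-h(\hat x))\,\mathrm{dist}(0,\partial h(x))\ge1$ for all $x\in U$ with $h(\hat x)<h(x)<h(\hat x)+a$ (where $\mathrm{dist}(0,\emptyset)=\infty$); it has the KL property with exponent $\theta\in[0,1)$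 at $\hat x$ if one can take $\varphi(\nu)=a_0\nu^{1-\theta}$ for some $a_0>0$. The function $h$ is a KL function (with exponent $\theta$) if this holds at every $\hat x\in\mathrm{dom}\,\partial h$. *Algorithm MBA$_{\ell_1/\ell_2}$.* Fix $\alpha>0$, $0<l_{\min}<l_{\max}$ and $x^0$ with $q(x^0)\le0$. Given $x^t$, put $\omega_t=\|x^t\|_1/\|x^t\|$ and choose any $\zeta^t\in\partial P_2(x^t)$ and any $l_t^0\in[l_{\min},l_{\max}]$. For $l=l_t^0,2l_t^0,4l_t^0,\dots$ let $\widetilde x$ be the minimizer of $$\|x\|_1-\frac{\omega_t}{\|x^t\|}\langle x,x^t\rangle+\frac\alpha2\|x-x^t\|^2\quad\text{s.t.}\quad q(x^t)+\langle\nabla P_1(x^t)-\zeta^t,x-x^t\rangle+\frac l2\|x-x^t\|^2\le0,$$ and stop at the first $l=:\bar l_t$ for which $q(\widetilde x)\le0$; set $x^{t+1}=\widetilde x$. *Potential function.* Fix $\rho>0$ with $\{x:q(x)\le0\}\subset\{x:\|x\|>\rho\}$, and for $(x,y,\zeta,w)\in\mathbb R^n\times\mathbb R^n\times\mathbb R^n\times\mathbb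 R$ let $$\widetilde F(x,y,\zeta,w)=\frac{\|x\|_1}{\|x\|}+\delta_{[\widetilde q\le0]}(x,y,\zeta,w)+\delta_{\|\cdot\|\ge\rho}(x),$$ $$\widetilde q(x,y,\zeta,w)=P_1(y)+\langle\nabla P_1(y),x-y\rangle+P_2^*(\zeta)-\langle\zeta,x\rangle+\frac w2\|x-y\|^2 .$$ **Theorem (global convergence and convergence rate of MBA$_{\ell_1/\ell_2}$).** Assume in addition that $P_1$ is twice continuously differentiable and that the GMFCQ holds at every point of $\{x:q(x)\le0\}$. Let $\{x^t\}$ be a sequence generated by MBA$_{\ell_1/\ell_2}$ and assume that it is bounded. If $\widetilde F$ is a KL function, then $\{x^t\}$ converges to a Clarke critical point $x^*$ of (P), and $x^*$ is stationary if $q$ is in addition regular at $x^*$. Moreover, if $\widetilde F$ is a KL function with exponent $\theta\in[0,1)$, then: 1. If $\theta=0$, then $\{x^t\}$ converges finitely, i.e. $x^t=x^*$ for all large $t$. 2. If $\theta\in(0,\frac12]$, then there are $c_0>0$, $Q_1\in(0,1)$ and $\underline t\in\mathbb N$ with $\|x^t-x^*\|\le c_0Q_1^t$ for all $t>\underline t$.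 3. If $\theta\in(\frac12,1)$, then there are $c_0>0$ and $\underline t\in\mathbb N$ with $\|x^t-x^*\|\le c_0\,t^{-\frac{1-\theta}{2\theta-1}}$ for all $t>\underline t$. -/

import Mathlib

open Filter Topology Set
open scoped Pointwise

namespace MBA

noncomputable section

/-! ### Variational analysis for extended-real-valued functions -/

section Subdifferentials

variable {E : Type*} [NormedAddCommGroup E] [InnerProductSpace ℝ E]

/-- `h : E → (-∞, ∞]` is proper (finite somewhere) and closed (lower semicontinuous). -/
def IsProperClosed (h : E → EReal) : Prop :=
  (∀ x, h x ≠ ⊥) ∧ (∃ x, h x ≠ ⊤) ∧ LowerSemicontinuous h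

/-- The regular (Fréchet) subdifferential; empty outside the domain of `h`. -/
def regularSubdiff (h : E → EReal) (xbar : E) : Set E :=
  {v | h xbar ≠ ⊤ ∧ h xbar ≠ ⊥ ∧
    0 ≤ liminf (fun x : E =>
      (h x - h xbar - ((inner ℝ v (x - xbar) : ℝ) : EReal)) / ((‖x - xbar‖ : ℝ) : EReal))
      (𝓝[≠] xbar)}

/-- The limiting (Mordukhovich) subdifferential; empty outside the domain of `h`. -/
def limitingSubdiff (h : E → EReal) (xbar : E) : Set E :=
  {v | h xbar ≠ ⊤ ∧ h xbar ≠ ⊥ ∧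
    ∃ (xs vs : ℕ → E),
      Tendsto xs atTop (𝓝 xbar) ∧
      Tendsto (fun k => h (xs k)) atTop (𝓝 (h xbar)) ∧
      (∀ k, vs k ∈ regularSubdiff h (xs k)) ∧
      Tendsto vs atTop (𝓝 v)}

/-- The domain of the limiting subdifferential. -/
def domSubdiff (h : E → EReal) : Set E :=
  {x | (limitingSubdiff h x).Nonempty}

/-- The limiting subdifferential of a real-valued function. -/
def realSubdiff (f : E → ℝ) (xbar : E) : Set E :=
  limitingSubdiff (fun x => (f x : EReal)) xbar

/-- The Clarke subdifferential of a (locally Lipschitz) real-valued function; the generalized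
directional derivative is an upper limit over `x → xbar`, `t ↓ 0`, taken in `[-∞, ∞]`. -/
def clarkeSubdiff (f : E → ℝ) (xbar : E) : Set E :=
  {v | ∀ w : E, ((inner ℝ v w : ℝ) : EReal) ≤
    limsup (fun p : E × ℝ => (((f (p.1 + p.2 • w) - f p.1) / p.2 : ℝ) : EReal))
      (𝓝 xbar ×ˢ 𝓝[>] (0 : ℝ))}

open Classical in
/-- The indicator function `δ_C`: `0` on `C` and `∞` off `C`. -/
def delta (C : Set E) (x : E) : EReal :=
  if x ∈ C then 0 else ⊤

/-- The regular normal cone of `C` at `x`. -/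
def regularNormalCone (C : Set E) (x : E) : Set E :=
  regularSubdiff (delta C) x

/-- The (limiting) normal cone of `C` at `x`. -/
def normalCone (C : Set E) (x : E) : Set E :=
  limitingSubdiff (delta C) x

/-- The epigraph of `f` in `E × ℝ` with the Euclidean product structure. -/
def epigraph (f : E → ℝ) : Set (WithLp 2 (E × ℝ)) :=
  {p | f p.fst ≤ p.snd}

/-- `f` is subdifferentially regular at `x`: its epigraph is regular at `(x, f x)`. -/
def IsRegularAt (f : E → ℝ) (x : E) : Prop :=
  normalCone (epigraph f) (WithLp.toLp 2 (x, f x)) =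
    regularNormalCone (epigraph f) (WithLp.toLp 2 (x, f x))

/-- The convex conjugate of a real-valued function, with values in `[-∞, ∞]`. -/
def conjugate (f : E → ℝ) (y : E) : EReal :=
  ⨆ x : E, ((inner ℝ x y - f x : ℝ) : EReal)

end Subdifferentials

/-! ### The Kurdyka–Łojasiewicz property -/

section KL

variable {E : Type*} [NormedAddCommGroup E] [InnerProductSpace ℝ E]

/-- `φ : [0, a) → [0, ∞)` is continuous and concave, `φ 0 = 0`, and `φ` is `C¹` on `(0, a)` with
positive derivative there (`a = ∞` is allowed). -/
structure IsDesingularizing (a : EReal) (φ : ℝ → ℝ) : Prop where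
  zero : φ 0 = 0
  nonneg : ∀ s : ℝ, 0 ≤ s → (s : EReal) < a → 0 ≤ φ s
  continuousOn : ContinuousOn φ {s : ℝ | 0 ≤ s ∧ (s : EReal) < a}
  concaveOn : ConcaveOn ℝ {s : ℝ | 0 ≤ s ∧ (s : EReal) < a} φ
  contDiffOn : ContDiffOn ℝ 1 φ {s : ℝ | 0 < s ∧ (s : EReal) < a}
  deriv_pos : ∀ s : ℝ, 0 < s → (s : EReal) < a → 0 < deriv φ s

/-- The KL inequality for `h` around `xhat` with the function `φ` on `[0, a)`. The distance is
extended-real-valued, so it is `∞` where the subdifferential is empty. -/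
def KLInequality (h : E → EReal) (xhat : E) (a : EReal) (φ : ℝ → ℝ) : Prop :=
  ∃ U ∈ 𝓝 xhat, ∀ x ∈ U, h xhat < h x → h x < h xhat + a →
    1 ≤ ENNReal.ofReal (deriv φ (h x - h xhat).toReal) *
      Metric.infEDist (0 : E) (limitingSubdiff h x)

/-- The KL property at a point of `dom ∂h`. -/
def KLAt (h : E → EReal) (xhat : E) : Prop :=
  ∃ (a : EReal) (φ : ℝ → ℝ), 0 < a ∧ IsDesingularizing a φ ∧ KLInequality h xhat a φ

/-- The KL property at a point of `dom ∂h` with exponent `θ`. -/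
def KLAtWithExponent (h : E → EReal) (θ : ℝ) (xhat : E) : Prop :=
  ∃ (a : EReal) (a₀ : ℝ), 0 < a ∧ 0 < a₀ ∧
    IsDesingularizing a (fun ν : ℝ => a₀ * ν ^ (1 - θ)) ∧
    KLInequality h xhat a (fun ν : ℝ => a₀ * ν ^ (1 - θ))

/-- KL functions. -/
def IsKLFunction (h : E → EReal) : Prop :=
  IsProperClosed h ∧ ∀ xhat ∈ domSubdiff h, KLAt h xhat

/-- KL functions with exponent `θ`. -/
def IsKLFunctionWithExponent (h : E → EReal) (θ : ℝ) : Prop :=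
  IsProperClosed h ∧ ∀ xhat ∈ domSubdiff h, KLAtWithExponent h θ xhat

end KL

/-! ### The constrained `ℓ₁/ℓ₂` problem: minimize `‖x‖₁ / ‖x‖` subject to `q x ≤ 0` -/

section Problem

variable {n : ℕ}

/-- The `ℓ₁` norm. -/
def l1norm (x : EuclideanSpace ℝ (Fin n)) : ℝ :=
  ∑ i, |x i|

/-- The objective `‖x‖₁ / ‖x‖`. -/
def ratio (x : EuclideanSpace ℝ (Fin n)) : ℝ :=
  l1norm x / ‖x‖

/-- The generalized Mangasarian–Fromovitz constraint qualification at `x` with `q x ≤ 0`. -/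
def GMFCQ (q : EuclideanSpace ℝ (Fin n) → ℝ) (x : EuclideanSpace ℝ (Fin n)) : Prop :=
  q x = 0 → (0 : EuclideanSpace ℝ (Fin n)) ∉ clarkeSubdiff q x

/-- Stationary points of the problem. -/
def IsStationary (q : EuclideanSpace ℝ (Fin n) → ℝ) (xbar : EuclideanSpace ℝ (Fin n)) : Prop :=
  q xbar ≤ 0 ∧
    (0 : EuclideanSpace ℝ (Fin n)) ∈
      limitingSubdiff (fun x => (ratio x : EReal) + delta {y | q y ≤ 0} x) xbar

/-- Clarke critical points of the problem. -/
def IsClarkeCritical (q : EuclideanSpace ℝ (Fin n) → ℝ)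
    (xbar : EuclideanSpace ℝ (Fin n)) : Prop :=
  q xbar ≤ 0 ∧ ∃ lam : ℝ, 0 ≤ lam ∧
    (0 : EuclideanSpace ℝ (Fin n)) ∈ realSubdiff ratio xbar + lam • clarkeSubdiff q xbar ∧
    lam * q xbar = 0

/-! ### The algorithm -/

/-- `xtilde` minimizes `‖x‖₁ - (ω / ‖xt‖) ⟨x, xt⟩ + (α / 2) ‖x - xt‖²`, with
`ω = ‖xt‖₁ / ‖xt‖`, over the ball
`q xt + ⟨∇P₁ xt - ζ, x - xt⟩ + (l / 2) ‖x - xt‖² ≤ 0`, where `q = P₁ - P₂`. -/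
def SolvesSubproblem (P₁ P₂ : EuclideanSpace ℝ (Fin n) → ℝ) (α : ℝ)
    (xt ζ : EuclideanSpace ℝ (Fin n)) (l : ℝ) (xtilde : EuclideanSpace ℝ (Fin n)) : Prop :=
  xtilde ∈ {x | (P₁ xt - P₂ xt) + inner ℝ (gradient P₁ xt - ζ) (x - xt)
      + l / 2 * ‖x - xt‖ ^ 2 ≤ 0} ∧
  IsMinOn (fun x => l1norm x - ratio xt / ‖xt‖ * inner ℝ x xt + α / 2 * ‖x - xt‖ ^ 2)
    {x | (P₁ xt - P₂ xt) + inner ℝ (gradient P₁ xt - ζ) (x - xt)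
      + l / 2 * ‖x - xt‖ ^ 2 ≤ 0} xtilde

/-- One outer iteration from `xt` with subgradient `ζ`: starting at some `l₀ ∈ [lmin, lmax]`, the
subproblem is solved with `l = l₀, 2 l₀, 4 l₀, …` until the solution is feasible, which happens
for the first time at `l = 2 ^ k * l₀ = lbar`; that solution is `xnext`. -/
def IsMBAStep (P₁ P₂ : EuclideanSpace ℝ (Fin n) → ℝ) (α lmin lmax : ℝ)
    (xt ζ : EuclideanSpace ℝ (Fin n)) (lbar : ℝ) (xnext : EuclideanSpace ℝ (Fin n)) : Prop :=
  ∃ l₀ ∈ Icc lmin lmax, ∃ (k : ℕ) (trial : ℕ → EuclideanSpace ℝ (Fin n)),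
    (∀ j ≤ k, SolvesSubproblem P₁ P₂ α xt ζ (2 ^ j * l₀) (trial j)) ∧
    (∀ j < k, ¬ (P₁ (trial j) - P₂ (trial j) ≤ 0)) ∧
    P₁ (trial k) - P₂ (trial k) ≤ 0 ∧
    xnext = trial k ∧ lbar = 2 ^ k * l₀

/-- `(x t, ζ t, lbar t)` is a sequence generated by the algorithm with parameters
`α`, `lmin`, `lmax`. -/
structure IsMBASequence (P₁ P₂ : EuclideanSpace ℝ (Fin n) → ℝ) (α lmin lmax : ℝ)
    (x ζ : ℕ → EuclideanSpace ℝ (Fin n)) (lbar : ℕ → ℝ) : Prop where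
  init : P₁ (x 0) - P₂ (x 0) ≤ 0
  subgradient : ∀ t, ζ t ∈ realSubdiff P₂ (x t)
  step : ∀ t, IsMBAStep P₁ P₂ α lmin lmax (x t) (ζ t) (lbar t) (x (t + 1))

/-! ### The potential function -/

/-- The space `ℝⁿ × ℝⁿ × ℝⁿ × ℝ` of points `(x, y, ζ, w)` with its Euclidean structure. -/
abbrev LiftedSpace (n : ℕ) : Type :=
  WithLp 2 (EuclideanSpace ℝ (Fin n) × WithLp 2 (EuclideanSpace ℝ (Fin n) ×
    WithLp 2 (EuclideanSpace ℝ (Fin n) × ℝ)))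

/-- The function
`P₁ y + ⟨∇P₁ y, x - y⟩ + P₂^* ζ - ⟨ζ, x⟩ + (w / 2) ‖x - y‖²` of `(x, y, ζ, w)`. -/
def qLifted (P₁ P₂ : EuclideanSpace ℝ (Fin n) → ℝ)
    (x y ζ : EuclideanSpace ℝ (Fin n)) (w : ℝ) : EReal :=
  ((P₁ y + inner ℝ (gradient P₁ y) (x - y) : ℝ) : EReal) + conjugate P₂ ζ
    - ((inner ℝ ζ x : ℝ) : EReal) + ((w / 2 * ‖x - y‖ ^ 2 : ℝ) : EReal)

/-- The potential function: `‖x‖₁ / ‖x‖` plus the indicators of `qLifted (x, y, ζ, w) ≤ 0` and of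
`ρ ≤ ‖x‖`. -/
def potential (P₁ P₂ : EuclideanSpace ℝ (Fin n) → ℝ) (ρ : ℝ) (z : LiftedSpace n) : EReal :=
  (ratio z.fst : EReal)
    + delta {u : LiftedSpace n |
        qLifted P₁ P₂ u.fst u.snd.fst u.snd.snd.fst u.snd.snd.snd ≤ 0} z
    + delta {x : EuclideanSpace ℝ (Fin n) | ρ ≤ ‖x‖} z.fst

end Problem

end

end MBA

namespace MBA

/-! ### Regular subgradients and normals in ε-form; Clarke subgradients of a smooth function minus a
convex one. -/

section Basics

variable {E : Type*} [NormedAddCommGroup E] [InnerProductSpace ℝ E]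

/-! The iterates are handled by the three-part descent scheme for KL functions: sufficient decrease,
a relative error bound, and an inequality that turns both into finite length.

Decrease: the current iterate has value zero in its own subproblem, so the minimizer has value at
most zero there. Cauchy–Schwarz then yields `IsBoundedRun.descent`, a drop of the ratio by a
multiple of the squared step.

Relative error: the convex subproblem satisfies Slater's condition by the GMFCQ and therefore has a
Lagrange multiplier. The multipliers stay bounded, since along a blow-up the rescaled optimality
conditions would put zero in the Clarke subdifferential of `q` at a point with `q = 0`
(`exists_multiplier_bound`). At the lifted point `(x (t+1), x t, ζ t, lbar t)` the potential lies
above a differentiable function that touches it: the ℓ₁ norm and the conjugate of `P₂` are replaced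
by affine minorants and the lifted constraint is added with its multiplier. The gradient of this
minorant is a regular subgradient, so no subdifferential sum rule is needed. Its norm is at most a
constant times the step (`exists_subgradient_potential`).

KL: the lifted points stay in a compact set, and every cluster point lies in the domain of the
subdifferential at the same level. The local inequalities merge into one (`exists_uniform_KL`).
Concavity of the desingularizing function makes the step lengths summable (`exists_limit_of_KL`).
The rates come from a recursion for the gap of the ratio to its limit, and the distance to the limit
is bounded by powers of that gap.

The limit is Clarke critical by passing to the limit in the optimality conditions. When `q` is
regular there, `q` has a regular subgradient, which for a smooth minus a convex function must be
`∇P₁ - η` for every subgradient `η` of `P₂`. The multiplier rule then becomes stationarity. -/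

theorem neg_lt_div_iff_le {e : EReal} {c i r ε : ℝ} (hr : 0 < r) :
    (((-ε : ℝ) : EReal) < (e - (c : EReal) - (i : EReal)) / (r : EReal)) ↔
      ((c + i - ε * r : ℝ) : EReal) < e := by
  have hr' : (0 : EReal) < (r : EReal) := by exact_mod_cast hr
  rw [EReal.lt_div_iff hr' (EReal.coe_ne_top r)]
  induction e with
  | bot => simp
  | top =>
    simp only [EReal.top_sub_coe, EReal.coe_lt_top, iff_true]
    rw [← EReal.coe_mul]; exact EReal.coe_lt_top _
  | coe e =>
    norm_cast
    constructor <;> intro h <;> linarith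

/-- All later work with regular subgradients uses this ε-form. The strict and the weak inequality
agree after halving `ε`, and the centre may be included because equality holds there. -/
theorem mem_regularSubdiff_iff {h : E → EReal} {x v : E} {c : ℝ} (hc : h x = c) :
    v ∈ regularSubdiff h x ↔ ∀ ε : ℝ, 0 < ε → ∀ᶠ y in 𝓝 x,
      ((c + inner ℝ v (y - x) - ε * ‖y - x‖ : ℝ) : EReal) ≤ h y := by
  have key : v ∈ regularSubdiff h x ↔ ∀ ε : ℝ, 0 < ε → ∀ᶠ y in 𝓝[≠] x,
      ((c + inner ℝ v (y - x) - ε * ‖y - x‖ : ℝ) : EReal) < h y := by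
    simp only [regularSubdiff, mem_ofPred_eq, hc, ne_eq, EReal.coe_ne_top, not_false_eq_true,
      EReal.coe_ne_bot, true_and]
    rw [le_liminf_iff]
    constructor
    · intro H ε hε
      filter_upwards [H (-ε : ℝ) (by exact_mod_cast neg_lt_zero.2 hε), self_mem_nhdsWithin]
        with y hy hyx
      exact (neg_lt_div_iff_le (norm_pos_iff.2 (sub_ne_zero.2 hyx))).1 hy
    · intro H b hb
      obtain ⟨r, hbr, hr⟩ := EReal.lt_iff_exists_real_btwn.1 hb
      have hr0 : r < 0 := by exact_mod_cast hr
      filter_upwards [H (-r) (by linarith), self_mem_nhdsWithin] with y hy hyx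
      refine hbr.trans ?_
      have := (neg_lt_div_iff_le (norm_pos_iff.2 (sub_ne_zero.2 hyx))).2 hy
      simpa using this
  rw [key]
  constructor
  · intro H ε hε
    have := H ε hε
    rw [eventually_nhdsWithin_iff] at this
    filter_upwards [this] with y hy
    by_cases hyx : y = x
    · subst hyx; simp [hc]
    · exact (hy hyx).le
  · intro H ε hε
    filter_upwards [(H (ε / 2) (by linarith)).filter_mono nhdsWithin_le_nhds, self_mem_nhdsWithin]
      with y hy hyx
    refine lt_of_lt_of_le ?_ hy
    have := norm_pos_iff.2 (sub_ne_zero.2 hyx)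
    norm_cast
    nlinarith

theorem mem_regularSubdiff_real_iff {f : E → ℝ} {x v : E} :
    v ∈ regularSubdiff (fun y => (f y : EReal)) x ↔ ∀ ε : ℝ, 0 < ε → ∀ᶠ y in 𝓝 x,
      f x + inner ℝ v (y - x) - ε * ‖y - x‖ ≤ f y := by
  refine (mem_regularSubdiff_iff (h := fun y => (f y : EReal)) (c := f x) rfl).trans ?_
  simp only [EReal.coe_le_coe_iff]

theorem mem_regularNormalCone_iff {C : Set E} {x v : E} (hx : x ∈ C) :
    v ∈ regularNormalCone C x ↔ ∀ ε : ℝ, 0 < ε → ∀ᶠ y in 𝓝 x, y ∈ C →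
      inner ℝ v (y - x) ≤ ε * ‖y - x‖ := by
  rw [regularNormalCone, mem_regularSubdiff_iff (c := 0) (by simp [delta, hx])]
  refine forall₂_congr fun ε _ => eventually_congr (Eventually.of_forall fun y => ?_)
  by_cases hy : y ∈ C
  · simp only [delta, hy, if_true, forall_const]
    norm_cast
    constructor <;> intro h <;> linarith
  · simp [delta, hy]

theorem regularSubdiff_subset_limitingSubdiff (h : E → EReal) (x : E) :
    regularSubdiff h x ⊆ limitingSubdiff h x := fun v hv =>
  ⟨hv.1, hv.2.1, fun _ => x, fun _ => v, tendsto_const_nhds, tendsto_const_nhds, fun _ => hv,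
    tendsto_const_nhds⟩

/-- A differentiable minorant touching `h` at `x` transfers its gradient. This replaces
subdifferential calculus for the potential and for the ratio. -/
theorem mem_regularSubdiff_of_hasFDerivAt {h : E → EReal} {Ψ : E → ℝ} {x v : E} {Ψ' : E →L[ℝ] ℝ}
    (hΨ : HasFDerivAt Ψ Ψ' x) (hv : ∀ y, Ψ' y = inner ℝ v y) (hx : h x = Ψ x)
    (hle : ∀ᶠ y in 𝓝 x, (Ψ y : EReal) ≤ h y) : v ∈ regularSubdiff h x := by
  rw [mem_regularSubdiff_iff hx]
  intro ε hε
  filter_upwards [hle, hΨ.isLittleO.bound hε] with y hy hb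
  refine le_trans ?_ hy
  rw [EReal.coe_le_coe_iff]
  rw [hv, Real.norm_eq_abs] at hb
  have := neg_abs_le (Ψ y - Ψ x - inner ℝ v (y - x))
  linarith

/-- The local inequality is applied at a point close to `x` on the segment towards `y`; convexity
scales it up to `y`, and the error is arbitrarily small. -/
theorem ConvexOn.inner_le_of_mem_regularSubdiff {f : E → ℝ} (hf : ConvexOn ℝ univ f) {x v : E}
    (hv : v ∈ regularSubdiff (fun y => (f y : EReal)) x) (y : E) :
    f x + inner ℝ v (y - x) ≤ f y := by
  rw [mem_regularSubdiff_real_iff] at hv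
  refine le_of_forall_pos_le_add fun δ hδ => ?_
  obtain ⟨ε, hε, hεδ⟩ : ∃ ε : ℝ, 0 < ε ∧ ε * ‖y - x‖ ≤ δ :=
    ⟨δ / (‖y - x‖ + 1), by positivity, by
      rw [div_mul_eq_mul_div, div_le_iff₀ (by positivity)]; nlinarith [norm_nonneg (y - x)]⟩
  have hlim : Tendsto (fun τ : ℝ => x + τ • (y - x)) (𝓝[>] 0) (𝓝 x) := by
    have : Continuous fun τ : ℝ => x + τ • (y - x) := by fun_prop
    simpa using (this.tendsto 0).mono_left nhdsWithin_le_nhds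
  have h1 : ∀ᶠ τ : ℝ in 𝓝[>] 0, τ ≤ 1 :=
    (eventually_le_nhds (by norm_num)).filter_mono nhdsWithin_le_nhds
  obtain ⟨τ, hτ, hτ1, hτ0⟩ := ((hlim.eventually (hv ε hε)).and
    (h1.and self_mem_nhdsWithin)).exists
  have hτ0 : 0 < τ := hτ0
  have hc := hf.2 (mem_univ x) (mem_univ y) (sub_nonneg.2 hτ1) hτ0.le (by ring)
  have he : (1 - τ) • x + τ • y = x + τ • (y - x) := by module
  rw [he] at hc
  simp only [add_sub_cancel_left, inner_smul_right, norm_smul, Real.norm_eq_abs, abs_of_pos hτ0,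
    smul_eq_mul] at hτ hc
  have : τ * (f x + inner ℝ v (y - x)) ≤ τ * (f y + ε * ‖y - x‖) := by nlinarith
  have := le_of_mul_le_mul_left this hτ0
  linarith

theorem ConvexOn.inner_le_of_mem_realSubdiff {f : E → ℝ} (hf : ConvexOn ℝ univ f)
    {x v : E} (hv : v ∈ realSubdiff f x) (y : E) :
    f x + inner ℝ v (y - x) ≤ f y := by
  obtain ⟨-, -, xs, vs, hxs, hfs, hmem, hvs⟩ := hv
  have hfs : Tendsto (fun k => f (xs k)) atTop (𝓝 (f x)) := EReal.tendsto_coe.1 hfs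
  refine le_of_tendsto' (hfs.add (hvs.inner (hxs.const_sub y))) fun k => ?_
  exact ConvexOn.inner_le_of_mem_regularSubdiff hf (hmem k) y

/-- Gradients minus convex subgradients are Clarke subgradients of a difference. -/
theorem sub_mem_clarkeSubdiff {P₁ P₂ q : E → ℝ} (hq : ∀ x, q x = P₁ x - P₂ x) {x g ζ : E}
    {D : E →L[ℝ] ℝ} (hD : HasFDerivAt P₁ D x) (hg : ∀ w, D w = inner ℝ g w)
    (hζ : ∀ y, P₂ x + inner ℝ ζ (y - x) ≤ P₂ y) : g - ζ ∈ clarkeSubdiff q x := by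
  intro w
  -- The difference quotient is based at `x - s • w` and ends at `x`. With this orientation the
  -- subgradient inequality of `P₂`, which enters with a minus sign, bounds the quotient from below.
  have hcurve : Tendsto (fun s : ℝ => (x - s • w, s)) (𝓝[>] 0) (𝓝 x ×ˢ 𝓝[>] (0 : ℝ)) := by
    refine Tendsto.prodMk ?_ tendsto_id
    have : Continuous fun τ : ℝ => x - τ • w := by fun_prop
    simpa using (this.tendsto 0).mono_left nhdsWithin_le_nhds
  refine le_trans ?_ (limsup_le_limsup_of_le (f := (𝓝[>] (0 : ℝ)).map
    (fun s : ℝ => (x - s • w, s))) hcurve)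
  have hder : Tendsto (fun s : ℝ => s⁻¹ * (P₁ x - P₁ (x - s • w)) - inner ℝ ζ w) (𝓝[>] 0)
      (𝓝 (inner ℝ (g - ζ) w)) := by
    rw [inner_sub_left]
    refine Tendsto.sub_const ?_ _
    have h1 : HasDerivAt (fun s : ℝ => P₁ (x - s • w)) (-(inner ℝ g w)) 0 := by
      have hl : HasDerivAt (fun s : ℝ => x - s • w) (-w) 0 := by
        simpa using ((hasDerivAt_id (0 : ℝ)).smul_const w).const_sub x
      have hD' : HasFDerivAt P₁ D (x - (0 : ℝ) • w) := by simpa using hD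
      have := hD'.comp_hasDerivAt (0 : ℝ) hl
      simpa [hg, Function.comp_def] using this
    have h2 := (h1.tendsto_slope_zero_right).neg
    simp only [neg_neg, zero_add, zero_smul, sub_zero, smul_eq_mul] at h2
    refine h2.congr fun s => by ring
  have hder' := (EReal.tendsto_coe.2 hder).limsup_eq
  rw [← hder', ← limsup_comp]
  refine limsup_le_limsup ?_
  filter_upwards [self_mem_nhdsWithin] with s hs
  have hs : 0 < s := hs
  simp only [Function.comp_apply, EReal.coe_le_coe_iff, sub_add_cancel, hq]
  have h3 := hζ (x - s • w)
  simp only [sub_sub_cancel_left, inner_neg_right, inner_smul_right] at h3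
  rw [le_div_iff₀ hs]
  have : (s⁻¹ * (P₁ x - P₁ (x - s • w)) - inner ℝ ζ w) * s =
    (P₁ x - P₁ (x - s • w)) - s * inner ℝ ζ w := by field_simp
  rw [this]; linarith

/-- The normal is tested only at points of the graph. By the Lipschitz bound their distance to `(x,
q x)` is at most `(1 + L) * ‖y - x‖`, whence the choice `ε / (1 + L)`. -/
theorem mem_regularSubdiff_of_mem_regularNormalCone_epigraph {q : E → ℝ} {x v : E} {L : NNReal}
    {s : Set E} (hs : s ∈ 𝓝 x)
    (hL : LipschitzOnWith L q s)
    (hv : WithLp.toLp 2 (v, (-1 : ℝ)) ∈ regularNormalCone (epigraph q) (WithLp.toLp 2 (x, q x))) :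
    v ∈ regularSubdiff (fun y => (q y : EReal)) x := by
  rw [mem_regularNormalCone_iff (by simp [epigraph])] at hv
  rw [mem_regularSubdiff_real_iff]
  intro ε hε
  have hLp : (0 : ℝ) < 1 + L := by positivity
  have hcont : Tendsto (fun y => (WithLp.toLp 2 (y, q y) : WithLp 2 (E × ℝ))) (𝓝 x)
      (𝓝 (WithLp.toLp 2 (x, q x))) := by
    have hqc : ContinuousAt q x := hL.continuousOn.continuousAt hs
    exact ((WithLp.prod_continuous_toLp 2 E ℝ).tendsto _).comp (continuousAt_id.prodMk hqc)
  filter_upwards [hcont.eventually (hv (ε / (1 + L)) (by positivity)), hs] with y hy hys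
  have hy := hy (by simp [epigraph])
  have hxs := mem_of_mem_nhds hs
  have hlip := hL.dist_le_mul y hys x hxs
  rw [dist_eq_norm, dist_eq_norm] at hlip
  have hnorm : ‖(WithLp.toLp 2 (y, q y) - WithLp.toLp 2 (x, q x) : WithLp 2 (E × ℝ))‖ ≤
      (1 + L) * ‖y - x‖ := by
    rw [WithLp.prod_norm_eq_of_L2]
    refine Real.sqrt_le_iff.2 ⟨by positivity, ?_⟩
    change ‖y - x‖ ^ 2 + ‖q y - q x‖ ^ 2 ≤ _
    have h0 := norm_nonneg (q y - q x)
    have h1 := norm_nonneg (y - x)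
    have : ‖q y - q x‖ ^ 2 ≤ (L * ‖y - x‖) ^ 2 := by gcongr
    nlinarith [mul_nonneg L.coe_nonneg (sq_nonneg ‖y - x‖)]
  rw [WithLp.prod_inner_apply] at hy
  have h4 : ε / (1 + L) * ‖(WithLp.toLp 2 (y, q y) - WithLp.toLp 2 (x, q x) : WithLp 2 (E × ℝ))‖
      ≤ ε * ‖y - x‖ := by
    calc _ ≤ ε / (1 + L) * ((1 + L) * ‖y - x‖) := by gcongr
      _ = _ := by field_simp
  have h5 := hy.trans h4
  simp at h5
  linarith

theorem toLp_mem_regularNormalCone_epigraph {q : E → ℝ} {x v : E}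
    (hv : v ∈ regularSubdiff (fun y => (q y : EReal)) x) :
    WithLp.toLp 2 (v, (-1 : ℝ)) ∈ regularNormalCone (epigraph q) (WithLp.toLp 2 (x, q x)) := by
  rw [mem_regularNormalCone_iff (by simp [epigraph])]
  rw [mem_regularSubdiff_real_iff] at hv
  intro ε hε
  have hc : Tendsto (fun p : WithLp 2 (E × ℝ) => p.fst) (𝓝 (WithLp.toLp 2 (x, q x))) (𝓝 x) := by
    have : Continuous fun p : WithLp 2 (E × ℝ) => p.fst := by fun_prop
    exact this.tendsto _
  filter_upwards [hc.eventually (hv ε hε)] with p hp hpe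
  have hpe : q p.fst ≤ p.snd := hpe
  rw [WithLp.prod_inner_apply]
  have h1 : ‖p.fst - x‖ ≤ ‖p - WithLp.toLp 2 (x, q x)‖ := by
    exact WithLp.norm_fst_le E (p - WithLp.toLp 2 (x, q x))
  have h2 : ε * ‖p.fst - x‖ ≤ ε * ‖p - WithLp.toLp 2 (x, q x)‖ := by gcongr
  simp
  linarith

end Basics

/-! ### Existence of regular subgradients, multipliers, and quadratic estimates. -/

section Optimality

variable {E : Type*} [NormedAddCommGroup E] [InnerProductSpace ℝ E]

theorem mem_regularSubdiff_of_sq {f : E → ℝ} {x v : E} (K : ℝ)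
    (h : ∀ᶠ y in 𝓝 x, f x + inner ℝ v (y - x) - K * ‖y - x‖ ^ 2 ≤ f y) :
    v ∈ regularSubdiff (fun y => (f y : EReal)) x := by
  rw [mem_regularSubdiff_real_iff]
  intro ε hε
  have hc : Tendsto (fun y => K * ‖y - x‖) (𝓝 x) (𝓝 0) := by
    have : Continuous fun y => K * ‖y - x‖ := by fun_prop
    simpa using this.tendsto x
  filter_upwards [h, hc.eventually (gt_mem_nhds hε)] with y hy hy'
  have hy' : K * ‖y - x‖ < ε := hy'
  nlinarith [norm_nonneg (y - x)]

theorem eq_zero_of_eventually_inner_le {x u : E}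
    (h : ∀ ε : ℝ, 0 < ε → ∀ᶠ y in 𝓝 x, inner ℝ u (y - x) ≤ ε * ‖y - x‖) : u = 0 := by
  by_contra hu
  have hpos := norm_pos_iff.2 hu
  have hlim : Tendsto (fun τ : ℝ => x + τ • u) (𝓝[>] 0) (𝓝 x) := by
    have : Continuous fun τ : ℝ => x + τ • u := by fun_prop
    simpa using (this.tendsto 0).mono_left nhdsWithin_le_nhds
  obtain ⟨τ, hτ, hτ0⟩ := ((hlim.eventually (h (‖u‖ / 2) (by positivity))).and
    self_mem_nhdsWithin).exists
  have hτ0 : 0 < τ := hτ0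
  simp only [add_sub_cancel_left, inner_smul_right, real_inner_self_eq_norm_sq, norm_smul,
    Real.norm_eq_abs, abs_of_pos hτ0] at hτ
  have : 0 < τ * ‖u‖ ^ 2 := by positivity
  nlinarith

/-- The subgradient inequality of `P₂` bounds `q` above, to first order, by the affine function with
slope `g - ζ`, while `v` bounds it below. The difference of the slopes then has no ascent direction.
-/
theorem eq_sub_of_mem_regularSubdiff {P₁ P₂ q : E → ℝ} (hq : ∀ x, q x = P₁ x - P₂ x)
    {x g ζ v : E} {D : E →L[ℝ] ℝ} (hD : HasFDerivAt P₁ D x) (hg : ∀ w, D w = inner ℝ g w)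
    (hζ : ∀ y, P₂ x + inner ℝ ζ (y - x) ≤ P₂ y)
    (hv : v ∈ regularSubdiff (fun y => (q y : EReal)) x) : v = g - ζ := by
  rw [mem_regularSubdiff_real_iff] at hv
  rw [← sub_eq_zero]
  refine eq_zero_of_eventually_inner_le (x := x) fun ε hε => ?_
  filter_upwards [hv (ε / 2) (by linarith), hD.isLittleO.bound (half_pos hε)] with y h1 h2
  have h3 := hζ y
  rw [hg, Real.norm_eq_abs] at h2
  have h4 := le_abs_self (P₁ y - P₁ x - inner ℝ g (y - x))
  rw [hq, hq] at h1
  simp only [inner_sub_left] at *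
  linarith

/-- Penalization by `K * ‖y - x‖ ^ 2` with `K` growing: the minimizer approaches `x`, and minus the
gradient of the penalty is a regular subgradient, bounded because `q` is Lipschitz. -/
theorem exists_tendsto_regularSubdiff [FiniteDimensional ℝ E] {q : E → ℝ} {x : E} {L : NNReal}
    {r : ℝ} (hr : 0 < r) (hL : LipschitzOnWith L q (Metric.closedBall x r)) :
    ∃ (y v : ℕ → E) (vbar : E), Tendsto y atTop (𝓝 x) ∧ Tendsto v atTop (𝓝 vbar) ∧
      (∀ k, v k ∈ regularSubdiff (fun y => (q y : EReal)) (y k)) := by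
  have hxr : x ∈ Metric.closedBall x r := Metric.mem_closedBall_self hr.le
  have step : ∀ k : ℕ, ∃ y v : E, ((k : ℝ) + 1) * ‖y - x‖ ≤ L ∧ ‖v‖ ≤ 2 * L ∧
      v ∈ regularSubdiff (fun y => (q y : EReal)) y := by
    intro k
    -- The bound `L / r < K` keeps the minimizer in the open ball, since `K * ‖y - x‖ ≤ L`; `k + 1 ≤
    -- K` forces convergence.
    obtain ⟨K, hKk, hKr⟩ : ∃ K : ℝ, (k : ℝ) + 1 ≤ K ∧ L / r < K :=
      ⟨max (k + 1) (L / r + 1), le_max_left _ _, (lt_add_one _).trans_le (le_max_right _ _)⟩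
    have hk0 : (0 : ℝ) ≤ k := Nat.cast_nonneg k
    have hK : 0 < K := by linarith
    have hcont : ContinuousOn (fun y => q y + K * ‖y - x‖ ^ 2) (Metric.closedBall x r) :=
      hL.continuousOn.add (by fun_prop)
    obtain ⟨y, hy, hmin⟩ := (isCompact_closedBall x r).exists_isMinOn ⟨x, hxr⟩ hcont
    have h1 : q y + K * ‖y - x‖ ^ 2 ≤ q x := by simpa using hmin hxr
    have h2 := hL.dist_le_mul y hy x hxr
    rw [dist_eq_norm, dist_eq_norm, Real.norm_eq_abs] at h2
    have h3 : K * ‖y - x‖ ≤ L := by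
      rcases (norm_nonneg (y - x)).eq_or_lt with h0 | h0
      · rw [← h0]; simp
      · have := neg_abs_le (q y - q x)
        by_contra! hlt
        nlinarith
    have hyr : y ∈ Metric.ball x r := by
      rw [Metric.mem_ball, dist_eq_norm]
      by_contra! hge
      rw [div_lt_iff₀ hr] at hKr
      nlinarith
    refine ⟨y, -((2 * K) • (y - x)), ?_, ?_, ?_⟩
    · exact le_trans (by gcongr) h3
    · rw [norm_neg, norm_smul, Real.norm_eq_abs, abs_of_pos (by linarith)]; linarith
    · refine mem_regularSubdiff_of_sq K ?_
      filter_upwards [Metric.isOpen_ball.mem_nhds hyr] with z hz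
      have hz' : q y + K * ‖y - x‖ ^ 2 ≤ q z + K * ‖z - x‖ ^ 2 :=
        hmin (Metric.ball_subset_closedBall hz)
      have he : ‖z - x‖ ^ 2 = ‖z - y‖ ^ 2 + 2 * inner ℝ (y - x) (z - y) + ‖y - x‖ ^ 2 := by
        rw [show z - x = (z - y) + (y - x) by abel, norm_add_sq_real, real_inner_comm]
      rw [inner_neg_left, real_inner_smul_left]
      nlinarith
  choose y v hy hv hmem using step
  have hyx : Tendsto y atTop (𝓝 x) := by
    rw [tendsto_iff_norm_sub_tendsto_zero]
    refine squeeze_zero (fun _ => norm_nonneg _) (fun k => ?_)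
      (tendsto_const_div_atTop_nhds_zero_nat (L : ℝ) |>.comp (tendsto_add_atTop_nat 1))
    have hk : (0 : ℝ) < k + 1 := by positivity
    simp only [Function.comp_apply, Nat.cast_add, Nat.cast_one]
    rw [le_div_iff₀ hk]
    linarith [hy k]
  obtain ⟨vbar, -, φ, hφ, hlim⟩ := tendsto_subseq_of_bounded
    (Metric.isBounded_closedBall (x := (0 : E)) (r := 2 * L)) (x := v)
    (fun k => by simpa using hv k)
  exact ⟨y ∘ φ, v ∘ φ, vbar, hyx.comp hφ.tendsto_atTop, hlim, fun k => hmem _⟩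

/-- Nearby regular subgradients lift to epigraph normals `(v, -1)` and converge to a limiting
normal. Regularity makes it a regular normal, which descends again to a subgradient. -/
theorem IsRegularAt.exists_mem_regularSubdiff [FiniteDimensional ℝ E] {q : E → ℝ}
    (hq : LocallyLipschitz q) {x : E} (hreg : IsRegularAt q x) :
    ∃ v, v ∈ regularSubdiff (fun y => (q y : EReal)) x := by
  obtain ⟨L, s, hs, hL⟩ := hq x
  obtain ⟨r, hr, hrs⟩ := Metric.nhds_basis_closedBall.mem_iff.1 hs
  obtain ⟨y, v, vbar, hy, hv, hmem⟩ := exists_tendsto_regularSubdiff hr (hL.mono hrs)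
  refine ⟨vbar, mem_regularSubdiff_of_mem_regularNormalCone_epigraph hs hL ?_⟩
  rw [IsRegularAt] at hreg
  rw [← hreg]
  have hto := (WithLp.prod_continuous_toLp 2 E ℝ)
  refine ⟨by simp [delta, epigraph], by simp [delta, epigraph],
    fun k => WithLp.toLp 2 (y k, q (y k)), fun k => WithLp.toLp 2 (v k, (-1 : ℝ)), ?_, ?_, ?_, ?_⟩
  · exact (hto.tendsto _).comp (hy.prodMk_nhds ((hq.continuous.tendsto x).comp hy))
  · simp [delta, epigraph]
  · exact fun k => toLp_mem_regularNormalCone_epigraph (hmem k)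
  · exact (hto.tendsto _).comp (hv.prodMk_nhds tendsto_const_nhds)

/-- Lagrange multiplier rule for one convex constraint satisfying Slater's condition. -/
theorem exists_multiplier {f g : E → ℝ} (hf : ConvexOn ℝ univ f) (hg : ConvexOn ℝ univ g) {x : E}
    (hx : g x ≤ 0) (hmin : ∀ y, g y ≤ 0 → f x ≤ f y) (hslater : ∃ z, g z < 0) :
    ∃ lam : ℝ, 0 ≤ lam ∧ lam * g x = 0 ∧ ∀ y, f x ≤ f y + lam * g y := by
  obtain ⟨z₀, hz₀⟩ := hslater
  -- The multiplier has to dominate the slopes coming from infeasible points and zero, and be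
  -- dominated by those from strictly feasible points. The two families are ordered by testing
  -- minimality at the convex combination of `y` and `z` where the interpolated value of `g`
  -- vanishes.
  obtain ⟨lam, hlo, hup⟩ := exists_between_of_forall_le
    (s := insert 0 {c | ∃ y, 0 < g y ∧ c = (f x - f y) / g y})
    (t := {c | ∃ z, g z < 0 ∧ c = (f z - f x) / (-g z)})
    ⟨0, mem_insert _ _⟩ ⟨_, z₀, hz₀, rfl⟩ (by
      rintro c hc d ⟨z, hz, rfl⟩
      rcases hc with rfl | ⟨y, hy, rfl⟩
      · exact div_nonneg (sub_nonneg.2 (hmin z hz.le)) (by linarith)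
      · have hs : 0 < g y - g z := by linarith
        have ha : 0 ≤ -g z / (g y - g z) := div_nonneg (by linarith) hs.le
        have hb : 0 ≤ g y / (g y - g z) := div_nonneg hy.le hs.le
        have hab : -g z / (g y - g z) + g y / (g y - g z) = 1 := by
          rw [← add_div]; exact (div_eq_one_iff_eq hs.ne').2 (by ring)
        have h1 := hg.2 (mem_univ y) (mem_univ z) ha hb hab
        have h2 := hf.2 (mem_univ y) (mem_univ z) ha hb hab
        simp only [smul_eq_mul] at h1 h2
        have h3 : -g z / (g y - g z) * g y + g y / (g y - g z) * g z = 0 := by ring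
        have h4 := (hmin _ (h1.trans h3.le)).trans h2
        have h5 : -g z / (g y - g z) * f y + g y / (g y - g z) * f z =
          (-g z * f y + g y * f z) / (g y - g z) := by ring
        rw [h5, le_div_iff₀ hs] at h4
        rw [div_le_div_iff₀ hy (by linarith)]
        linarith)
  have h0 : 0 ≤ lam := hlo (mem_insert _ _)
  have hall : ∀ y, f x ≤ f y + lam * g y := by
    intro y
    rcases lt_trichotomy (g y) 0 with h | h | h
    · have := hup ⟨y, h, rfl⟩
      rw [le_div_iff₀ (by linarith)] at this
      linarith
    · rw [h]; linarith [hmin y h.le]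
    · have : (f x - f y) / g y ≤ lam := hlo (mem_insert_of_mem _ ⟨y, h, rfl⟩)
      rw [div_le_iff₀ h] at this
      linarith
  exact ⟨lam, h0, le_antisymm (mul_nonpos_of_nonneg_of_nonpos h0 hx) (by linarith [hall x]), hall⟩

theorem convexOn_norm_sub_sq (c : E) : ConvexOn ℝ univ fun y : E => ‖y - c‖ ^ 2 := by
  have h : ConvexOn ℝ univ fun y : E => ‖y - c‖ := by
    simpa [dist_eq_norm] using convexOn_univ_dist c
  exact h.pow (fun _ _ => norm_nonneg _) 2

theorem convexOn_inner_sub (a c : E) : ConvexOn ℝ univ fun y : E => inner ℝ a (y - c) := by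
  refine ⟨convex_univ, fun y _ z _ s t _ _ hst => le_of_eq ?_⟩
  have : s • y + t • z - c = s • (y - c) + t • (z - c) := by
    rw [smul_sub, smul_sub, sub_add_sub_comm, ← add_smul, hst, one_smul]
  beta_reduce
  rw [this, inner_add_right, inner_smul_right, inner_smul_right]; rfl

/-- Expanding the quadratic around `x` leaves a second-order error, so the slope is a regular
subgradient of `ψ`; convexity makes its inequality global and removes the error. -/
theorem inner_le_of_forall_add_quadratic_le {ψ : E → ℝ} (hψ : ConvexOn ℝ univ ψ) {x a c : E}
    {k : ℝ} (h : ∀ y, ψ x + inner ℝ a (x - c) + k / 2 * ‖x - c‖ ^ 2 ≤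
      ψ y + inner ℝ a (y - c) + k / 2 * ‖y - c‖ ^ 2) (y : E) :
    ψ x + inner ℝ (-(a + k • (x - c))) (y - x) ≤ ψ y := by
  refine ConvexOn.inner_le_of_mem_regularSubdiff hψ (mem_regularSubdiff_of_sq (k / 2) ?_) y
  refine Eventually.of_forall fun z => ?_
  have he : ‖z - c‖ ^ 2 = ‖z - x‖ ^ 2 + 2 * inner ℝ (x - c) (z - x) + ‖x - c‖ ^ 2 := by
    rw [show z - c = (z - x) + (x - c) by abel, norm_add_sq_real, real_inner_comm]
  have he' : inner ℝ a (z - c) = inner ℝ a (z - x) + inner ℝ a (x - c) := by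
    rw [← inner_add_right]; congr 1; abel
  have := h z
  rw [he, he'] at this
  rw [inner_neg_left, inner_add_left, real_inner_smul_left]
  linarith

/-- The mean value inequality on the segment gives `L` in place of the sharp `L / 2`, which only
affects the constant in the bound for `lbar`. -/
theorem le_add_inner_add_sq [CompleteSpace E] {P : E → ℝ} (hP : Differentiable ℝ P) {L : NNReal}
    (hL : LipschitzWith L (gradient P)) (x y : E) :
    P y ≤ P x + inner ℝ (gradient P x) (y - x) + L * ‖y - x‖ ^ 2 := by
  have h := Convex.norm_image_sub_le_of_norm_hasFDerivWithin_le' (𝕜 := ℝ) (f := P)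
    (f' := fderiv ℝ P) (φ := fderiv ℝ P x) (C := L * ‖y - x‖) (s := segment ℝ x y)
    (fun z _ => (hP z).hasFDerivAt.hasFDerivWithinAt) (fun z hz => by
      have h1 : ‖fderiv ℝ P z - fderiv ℝ P x‖ = ‖gradient P z - gradient P x‖ := by
        simp only [gradient]
        rw [← map_sub, LinearIsometryEquiv.norm_map]
      rw [h1, ← dist_eq_norm]
      refine (hL.dist_le_mul z x).trans ?_
      rw [dist_eq_norm]
      gcongr
      obtain ⟨a, b, ha, hb, hab, rfl⟩ := hz
      have : a • x + b • y - x = b • (y - x) := by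
        rw [← eq_sub_iff_add_eq] at hab; subst hab; module
      rw [this, norm_smul, Real.norm_eq_abs, abs_of_nonneg hb]
      exact mul_le_of_le_one_left (norm_nonneg _) (by linarith))
    (convex_segment x y) (left_mem_segment ℝ x y) (right_mem_segment ℝ x y)
  rw [← inner_gradient_left, Real.norm_eq_abs] at h
  have := le_abs_self (P y - P x - inner ℝ (gradient P x) (y - x))
  nlinarith

/-- The inequality is tested at distance one from `x` in the direction of `ζ`. -/
theorem norm_subgradient_le {f : E → ℝ} {x ζ : E} (h : ∀ y, f x + inner ℝ ζ (y - x) ≤ f y)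
    {R B : ℝ} (hB : ∀ y, ‖y‖ ≤ R + 1 → |f y| ≤ B) (hx : ‖x‖ ≤ R) : ‖ζ‖ ≤ 2 * B := by
  rcases eq_or_ne ζ 0 with rfl | hζ
  · have := (abs_nonneg _).trans (hB x (by linarith))
    simp; linarith
  have hpos := norm_pos_iff.2 hζ
  have hu : ‖‖ζ‖⁻¹ • ζ‖ = 1 := norm_smul_inv_norm hζ
  have h1 := h (x + ‖ζ‖⁻¹ • ζ)
  rw [add_sub_cancel_left, inner_smul_right, real_inner_self_eq_norm_sq] at h1
  have h2 : ‖ζ‖⁻¹ * ‖ζ‖ ^ 2 = ‖ζ‖ := by field_simp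
  have h3 := abs_le.1 (hB x (by linarith))
  have h4 := abs_le.1 (hB (x + ‖ζ‖⁻¹ • ζ) ((norm_add_le _ _).trans (by linarith)))
  linarith

end Optimality

/-! ### Lipschitz estimates for the ratio away from the origin. -/

section Objective

variable {n : ℕ}

theorem l1norm_nonneg (x : EuclideanSpace ℝ (Fin n)) : 0 ≤ l1norm x :=
  Finset.sum_nonneg fun _ _ => abs_nonneg _

theorem l1norm_add_le (x y : EuclideanSpace ℝ (Fin n)) : l1norm (x + y) ≤ l1norm x + l1norm y := by
  rw [l1norm, l1norm, l1norm, ← Finset.sum_add_distrib]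
  exact Finset.sum_le_sum fun i _ => by simpa using abs_add_le (x i) (y i)

theorem l1norm_smul (c : ℝ) (x : EuclideanSpace ℝ (Fin n)) : l1norm (c • x) = |c| * l1norm x := by
  simp [l1norm, Finset.mul_sum, abs_mul]

theorem convexOn_l1norm : ConvexOn ℝ univ (l1norm (n := n)) := by
  refine ⟨convex_univ, fun x _ y _ a b ha hb _ => (l1norm_add_le _ _).trans ?_⟩
  rw [l1norm_smul, l1norm_smul, abs_of_nonneg ha, abs_of_nonneg hb]; rfl

theorem l1norm_le (x : EuclideanSpace ℝ (Fin n)) : l1norm x ≤ n * ‖x‖ := by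
  refine (Finset.sum_le_card_nsmul _ _ ‖x‖ fun i _ => ?_).trans (by simp)
  exact PiLp.norm_apply_le x i

theorem abs_l1norm_sub_le (x y : EuclideanSpace ℝ (Fin n)) :
    |l1norm x - l1norm y| ≤ n * ‖x - y‖ := by
  have h1 := l1norm_add_le (x - y) y
  have h2 := l1norm_add_le (y - x) x
  rw [sub_add_cancel] at h1 h2
  have h3 := l1norm_le (x - y)
  have h4 := l1norm_le (y - x)
  rw [norm_sub_rev] at h4
  exact abs_le.2 ⟨by linarith, by linarith⟩

theorem continuous_l1norm : Continuous (l1norm (n := n)) := by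
  unfold l1norm; fun_prop

theorem ratio_nonneg (x : EuclideanSpace ℝ (Fin n)) : 0 ≤ ratio x :=
  div_nonneg (l1norm_nonneg x) (norm_nonneg x)

theorem ratio_le (x : EuclideanSpace ℝ (Fin n)) : ratio x ≤ n :=
  div_le_of_le_mul₀ (norm_nonneg x) (Nat.cast_nonneg n) (l1norm_le x)

theorem continuousAt_ratio {x : EuclideanSpace ℝ (Fin n)} (hx : x ≠ 0) : ContinuousAt ratio x :=
  continuous_l1norm.continuousAt.div continuous_norm.continuousAt (norm_ne_zero_iff.2 hx)

theorem abs_ratio_sub_le {x y : EuclideanSpace ℝ (Fin n)} {ρ : ℝ} (hρ : 0 < ρ) (hx : ρ ≤ ‖x‖)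
    (hy : y ≠ 0) : |ratio x - ratio y| ≤ 2 * n / ρ * ‖x - y‖ := by
  have hx0 : 0 < ‖x‖ := hρ.trans_le hx
  have hy0 : 0 < ‖y‖ := norm_pos_iff.2 hy
  have he : ratio x - ratio y = ((l1norm x - l1norm y) + ratio y * (‖y‖ - ‖x‖)) / ‖x‖ := by
    unfold ratio; field_simp; ring
  rw [he, abs_div, abs_of_pos hx0, div_le_iff₀ hx0]
  have h1 := abs_l1norm_sub_le x y
  have h2 : |ratio y * (‖y‖ - ‖x‖)| ≤ n * ‖x - y‖ := by
    rw [abs_mul, abs_of_nonneg (ratio_nonneg y), norm_sub_rev]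
    exact mul_le_mul (ratio_le y) (abs_norm_sub_norm_le y x) (abs_nonneg _) (Nat.cast_nonneg n)
  have h3 : 2 * n * ‖x - y‖ ≤ 2 * n / ρ * ‖x - y‖ * ‖x‖ := by
    calc 2 * n * ‖x - y‖ = 2 * n / ρ * ‖x - y‖ * ρ := by field_simp
      _ ≤ _ := by gcongr
  linarith [abs_add_le (l1norm x - l1norm y) (ratio y * (‖y‖ - ‖x‖))]

theorem norm_normalize_sub_le {E : Type*} [NormedAddCommGroup E] [NormedSpace ℝ E] {x y : E}
    {ρ : ℝ} (hρ : 0 < ρ) (hx : ρ ≤ ‖x‖) (hy : y ≠ 0) :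
    ‖‖x‖⁻¹ • x - ‖y‖⁻¹ • y‖ ≤ 2 / ρ * ‖x - y‖ := by
  have hx0 : 0 < ‖x‖ := hρ.trans_le hx
  have hy0 : 0 < ‖y‖ := norm_pos_iff.2 hy
  have he : ‖x‖⁻¹ • x - ‖y‖⁻¹ • y = ‖x‖⁻¹ • ((x - y) + ((‖y‖ - ‖x‖) * ‖y‖⁻¹) • y) := by
    rw [sub_mul, mul_inv_cancel₀ hy0.ne', sub_smul, one_smul, sub_add_sub_cancel, smul_sub,
      mul_smul, inv_smul_smul₀ hx0.ne']
  rw [he, norm_smul, norm_inv, norm_norm]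
  have h1 : ‖((‖y‖ - ‖x‖) * ‖y‖⁻¹) • y‖ ≤ ‖x - y‖ := by
    rw [norm_smul, norm_mul, norm_inv, norm_norm, mul_assoc, inv_mul_cancel₀ hy0.ne', mul_one,
      norm_sub_rev x y]
    exact abs_norm_sub_norm_le y x
  calc ‖x‖⁻¹ * ‖(x - y) + ((‖y‖ - ‖x‖) * ‖y‖⁻¹) • y‖ ≤ ρ⁻¹ * (‖x - y‖ + ‖x - y‖) := by
        gcongr; exact (norm_add_le _ _).trans (by gcongr)
    _ = _ := by ring

/-- Up to sign and the factor `‖x‖⁻¹`, the vector `(ratio x / ‖x‖) • x` is the part of a subgradient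
of the ratio caused by the denominator. Its Lipschitz continuity is what makes the first block of
the potential's subgradient small. -/
theorem norm_ratio_smul_sub_le {x y : EuclideanSpace ℝ (Fin n)} {ρ : ℝ} (hρ : 0 < ρ)
    (hx : ρ ≤ ‖x‖) (hy : y ≠ 0) :
    ‖(ratio x / ‖x‖) • x - (ratio y / ‖y‖) • y‖ ≤ 4 * n / ρ * ‖x - y‖ := by
  have hy0 : 0 < ‖y‖ := norm_pos_iff.2 hy
  have he : (ratio x / ‖x‖) • x - (ratio y / ‖y‖) • y =
      ratio x • (‖x‖⁻¹ • x - ‖y‖⁻¹ • y) + (ratio x - ratio y) • (‖y‖⁻¹ • y) := by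
    simp only [div_eq_mul_inv]; module
  rw [he]
  refine (norm_add_le _ _).trans ?_
  rw [norm_smul, norm_smul, Real.norm_eq_abs, Real.norm_eq_abs, abs_of_nonneg (ratio_nonneg x),
    show ‖‖y‖⁻¹ • y‖ = 1 from norm_smul_inv_norm (𝕜 := ℝ) hy, mul_one]
  have h1 : ratio x * ‖‖x‖⁻¹ • x - ‖y‖⁻¹ • y‖ ≤ n * (2 / ρ * ‖x - y‖) :=
    mul_le_mul (ratio_le x) (norm_normalize_sub_le hρ hx hy) (norm_nonneg _) (Nat.cast_nonneg n)
  have h2 := abs_ratio_sub_le hρ hx hy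
  calc _ ≤ n * (2 / ρ * ‖x - y‖) + 2 * n / ρ * ‖x - y‖ := add_le_add h1 h2
    _ = _ := by ring

end Objective

/-! ### Descent, feasibility and optimality conditions for one subproblem. -/

section Subproblem

variable {n : ℕ} {P₁ P₂ : EuclideanSpace ℝ (Fin n) → ℝ} {α l : ℝ}
  {xt ζ xn : EuclideanSpace ℝ (Fin n)}

theorem SolvesSubproblem.ratio_add_le (h : SolvesSubproblem P₁ P₂ α xt ζ l xn)
    (hxt : P₁ xt - P₂ xt ≤ 0) (ht : xt ≠ 0) (hn : xn ≠ 0) {M : ℝ} (hM : ‖xn‖ ≤ M) (hα : 0 ≤ α) :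
    ratio xn + α / (2 * M) * ‖xn - xt‖ ^ 2 ≤ ratio xt := by
  have ht0 : 0 < ‖xt‖ := norm_pos_iff.2 ht
  have hn0 : 0 < ‖xn‖ := norm_pos_iff.2 hn
  -- Comparison with the feasible point `xt`, where the objective vanishes.
  have h1 := h.2 (show xt ∈ _ by simpa using hxt)
  simp only [mem_ofPred_eq, sub_self, norm_zero, real_inner_self_eq_norm_sq] at h1
  have h2 : l1norm xt - ratio xt / ‖xt‖ * ‖xt‖ ^ 2 = 0 := by unfold ratio; field_simp; ring
  have h3 : ratio xt / ‖xt‖ * inner ℝ xn xt ≤ ratio xt * ‖xn‖ := by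
    calc ratio xt / ‖xt‖ * inner ℝ xn xt ≤ ratio xt / ‖xt‖ * (‖xn‖ * ‖xt‖) := by
          gcongr
          · exact div_nonneg (ratio_nonneg _) ht0.le
          · exact real_inner_le_norm _ _
      _ = _ := by field_simp
  have h4 : l1norm xn = ratio xn * ‖xn‖ := by unfold ratio; field_simp
  have h5 : α / (2 * M) * ‖xn - xt‖ ^ 2 * ‖xn‖ ≤ α / 2 * ‖xn - xt‖ ^ 2 := by
    calc α / (2 * M) * ‖xn - xt‖ ^ 2 * ‖xn‖ ≤ α / (2 * M) * ‖xn - xt‖ ^ 2 * M := by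
          have : 0 < M := hn0.trans_le hM
          gcongr
      _ = _ := by have : 0 < M := hn0.trans_le hM
                  field_simp
  have h6 : (ratio xn + α / (2 * M) * ‖xn - xt‖ ^ 2) * ‖xn‖ ≤ ratio xt * ‖xn‖ := by
    rw [add_mul]; nlinarith
  exact le_of_mul_le_mul_right h6 hn0

theorem SolvesSubproblem.feasible (h : SolvesSubproblem P₁ P₂ α xt ζ l xn)
    (hP : Differentiable ℝ P₁) {L : NNReal} (hL : LipschitzWith L (gradient P₁))
    (hζ : ∀ y, P₂ xt + inner ℝ ζ (y - xt) ≤ P₂ y) (hl : 2 * L ≤ l) : P₁ xn - P₂ xn ≤ 0 := by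
  have h1 := h.1
  simp only [mem_ofPred_eq, inner_sub_left] at h1
  have h2 := le_add_inner_add_sq hP hL xt xn
  have h3 := hζ xn
  nlinarith [sq_nonneg ‖xn - xt‖]

theorem SolvesSubproblem.exists_multiplier (h : SolvesSubproblem P₁ P₂ α xt ζ l xn) (hl : 0 ≤ l)
    (hα : 0 ≤ α)
    (hxt : P₁ xt - P₂ xt ≤ 0) (hslater : P₁ xt - P₂ xt = 0 → gradient P₁ xt - ζ ≠ 0) :
    ∃ lam : ℝ, 0 ≤ lam ∧
      lam * ((P₁ xt - P₂ xt) + inner ℝ (gradient P₁ xt - ζ) (xn - xt)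
        + l / 2 * ‖xn - xt‖ ^ 2) = 0 ∧
      ∀ y, l1norm xn + inner ℝ ((ratio xt / ‖xt‖) • xt - α • (xn - xt)
        - lam • (gradient P₁ xt - ζ + l • (xn - xt))) (y - xn) ≤ l1norm y := by
  set g := gradient P₁ xt - ζ with hg
  set b := P₁ xt - P₂ xt with hb
  have hsq := convexOn_norm_sub_sq xt
  have hG : ConvexOn ℝ univ fun y => b + inner ℝ g (y - xt) + l / 2 * ‖y - xt‖ ^ 2 :=
    ((convexOn_const b convex_univ).add (convexOn_inner_sub g xt)).add
      (hsq.smul (by positivity : 0 ≤ l / 2))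
  have hF : ConvexOn ℝ univ fun y => l1norm y + inner ℝ (-((ratio xt / ‖xt‖) • xt)) (y - 0)
      + α / 2 * ‖y - xt‖ ^ 2 :=
    (convexOn_l1norm.add (convexOn_inner_sub _ 0)).add (hsq.smul (by positivity : 0 ≤ α / 2))
  have hobj : ∀ y, l1norm y - ratio xt / ‖xt‖ * inner ℝ y xt + α / 2 * ‖y - xt‖ ^ 2 =
      l1norm y + inner ℝ (-((ratio xt / ‖xt‖) • xt)) (y - 0) + α / 2 * ‖y - xt‖ ^ 2 := by
    intro y
    rw [sub_zero, inner_neg_left, real_inner_smul_left, real_inner_comm]; ring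
  obtain ⟨lam, h0, hc, hall⟩ := MBA.exists_multiplier hF hG h.1 (fun y hy => by
    rw [← hobj, ← hobj]; exact h.2 hy) (by
    rcases hxt.lt_or_eq with hlt | heq
    · exact ⟨xt, by simpa using hlt⟩
    · have hgpos := norm_pos_iff.2 (hslater heq)
      -- A Slater point found by a short step against the constraint gradient; `l + 1` instead of
      -- `l` also covers `l = 0`.
      refine ⟨xt - (1 / (l + 1)) • g, ?_⟩
      simp only [sub_sub_cancel_left, heq, inner_neg_right, inner_smul_right,
        real_inner_self_eq_norm_sq, norm_neg, norm_smul, norm_div, norm_one, Real.norm_eq_abs,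
        abs_of_pos (by linarith : 0 < l + 1)]
      have : 0 + -(1 / (l + 1) * ‖g‖ ^ 2) + l / 2 * (1 / (l + 1) * ‖g‖) ^ 2 =
          -(‖g‖ ^ 2 * (l + 2) / (2 * (l + 1) ^ 2)) := by field_simp; ring
      rw [this]
      have : 0 < ‖g‖ ^ 2 * (l + 2) / (2 * (l + 1) ^ 2) := by positivity
      linarith)
  refine ⟨lam, h0, hc, fun y => ?_⟩
  have key := inner_le_of_forall_add_quadratic_le convexOn_l1norm (x := xn) (c := xt)
    (a := -((ratio xt / ‖xt‖) • xt) + lam • g) (k := α + lam * l) (fun y => by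
      have h1 := hall y
      have h2 : ∀ y, inner ℝ (-((ratio xt / ‖xt‖) • xt) + lam • g) (y - xt) =
          inner ℝ (-((ratio xt / ‖xt‖) • xt)) (y - 0) + lam * inner ℝ g (y - xt)
            - inner ℝ (-((ratio xt / ‖xt‖) • xt)) xt := by
        intro y
        rw [inner_add_left, real_inner_smul_left g, sub_zero, inner_sub_right _ y xt]; ring
      rw [h2, h2]
      have h3 : lam * (b + inner ℝ g (y - xt) + l / 2 * ‖y - xt‖ ^ 2) =
        lam * b + lam * inner ℝ g (y - xt) + lam * l / 2 * ‖y - xt‖ ^ 2 := by ring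
      have h4 : lam * b + lam * inner ℝ g (xn - xt) + lam * l / 2 * ‖xn - xt‖ ^ 2 = 0 := by
        rw [← hc]; ring
      rw [h3] at h1
      linarith) y
  convert key using 4
  module

end Subproblem

/-! ### Fenchel–Young inequality and its equality case. -/

section Conjugate

variable {E : Type*} [NormedAddCommGroup E] [InnerProductSpace ℝ E]

theorem le_conjugate (f : E → ℝ) (x ζ : E) :
    ((inner ℝ x ζ - f x : ℝ) : EReal) ≤ conjugate f ζ :=
  le_iSup (fun x : E => ((inner ℝ x ζ - f x : ℝ) : EReal)) x

theorem conjugate_eq {f : E → ℝ} {x ζ : E} (h : ∀ y, f x + inner ℝ ζ (y - x) ≤ f y) :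
    conjugate f ζ = ((inner ℝ x ζ - f x : ℝ) : EReal) := by
  refine le_antisymm (iSup_le fun y => ?_) (le_conjugate f x ζ)
  rw [EReal.coe_le_coe_iff]
  have := h y
  rw [inner_sub_right, real_inner_comm, real_inner_comm x] at this
  linarith

end Conjugate

/-! ### Derivatives of the smooth minorants. -/

section Derivatives

variable {E F : Type*} [NormedAddCommGroup E] [InnerProductSpace ℝ E] [NormedAddCommGroup F]
  [NormedSpace ℝ F]

theorem hasFDerivAt_norm_inv {x : E} (hx : x ≠ 0) :
    HasFDerivAt (fun y : E => ‖y‖⁻¹) (-(‖x‖ ^ 3)⁻¹ • innerSL ℝ x) x := by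
  have hx0 : 0 < ‖x‖ := norm_pos_iff.2 hx
  have h1 := (hasStrictFDerivAt_norm_sq x).hasFDerivAt
  have h2 : HasDerivAt (fun u : ℝ => (√u)⁻¹) (-(1 / (2 * √(‖x‖ ^ 2))) / √(‖x‖ ^ 2) ^ 2)
      (‖x‖ ^ 2) :=
    (Real.hasDerivAt_sqrt (by positivity)).inv (by rw [Real.sqrt_sq hx0.le]; positivity)
  have h3 := h2.comp_hasFDerivAt x h1
  rw [Real.sqrt_sq hx0.le] at h3
  have he : (fun u : ℝ => (√u)⁻¹) ∘ (fun y : E => ‖y‖ ^ 2) = fun y : E => ‖y‖⁻¹ := by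
    ext y; simp [Real.sqrt_sq (norm_nonneg y)]
  rw [he] at h3
  refine h3.congr_fderiv ?_
  ext w
  simp only [smul_apply, innerSL_apply_apply, smul_eq_mul, nsmul_eq_mul, Nat.cast_ofNat]
  field_simp

theorem hasFDerivAt_ratio_minorant (c : ℝ) (s : E) {x : E} (hx : x ≠ 0) :
    HasFDerivAt (fun y : E => (c + inner ℝ s (y - x)) * ‖y‖⁻¹)
      (innerSL ℝ (‖x‖⁻¹ • s - (c / ‖x‖ ^ 3) • x)) x := by
  have h1 : HasFDerivAt (fun y : E => c + inner ℝ s (y - x)) (innerSL ℝ s) x :=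
    ((innerSL ℝ s).hasFDerivAt.comp x ((hasFDerivAt_id x).sub_const x)).const_add c
  have h2 := h1.mul (hasFDerivAt_norm_inv hx)
  refine h2.congr_fderiv ?_
  ext w
  simp only [sub_self, inner_zero_right, add_zero, add_apply, smul_apply, innerSL_apply_apply,
    smul_eq_mul, inner_sub_left, real_inner_smul_left]
  ring

/-- This is the lifted constraint with the conjugate replaced by an affine function with slope `c`
and offset `b`. Differentiating `gradient P` along `Y` is where second derivatives of `P` enter; the
adjoint avoids any appeal to symmetry of the Hessian. -/
theorem exists_hasFDerivAt_lifted [CompleteSpace E] {P : E → ℝ} (hP : ContDiff ℝ 2 P)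
    (X Y Z : F →L[ℝ] E) (W : F →L[ℝ] ℝ) (c : E) (b : ℝ) (z : F) :
    ∃ D : F →L[ℝ] ℝ, HasFDerivAt (fun u => P (Y u) + inner ℝ (gradient P (Y u)) (X u - Y u)
        + (inner ℝ c (Z u) - b) - inner ℝ (Z u) (X u) + W u / 2 * ‖X u - Y u‖ ^ 2) D z ∧
      ∀ d, D d = inner ℝ (gradient P (Y z) - Z z + W z • (X z - Y z)) (X d)
        + inner ℝ (ContinuousLinearMap.adjoint (fderiv ℝ (gradient P) (Y z)) (X z - Y z)
            - W z • (X z - Y z)) (Y d)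
        + inner ℝ (c - X z) (Z d) + ‖X z - Y z‖ ^ 2 / 2 * W d := by
  have hd : Differentiable ℝ P := hP.differentiable (by norm_num)
  have hgd : Differentiable ℝ (gradient P) := by
    have h1 : ContDiff ℝ 1 (fderiv ℝ P) := hP.fderiv_right (by norm_num)
    exact (InnerProductSpace.toDual ℝ E).symm.differentiable.comp (h1.differentiable (by norm_num))
  have hX := X.hasFDerivAt (x := z)
  have hY := Y.hasFDerivAt (x := z)
  have hZ := Z.hasFDerivAt (x := z)
  have hW := W.hasFDerivAt (x := z)
  have h1 := (hd (Y z)).hasFDerivAt.comp z hY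
  have h2 := ((hgd (Y z)).hasFDerivAt.comp z hY).inner ℝ (hX.sub hY)
  have h3 := ((hasFDerivAt_const c z).inner ℝ hZ).sub_const b
  have h4 := hZ.inner ℝ hX
  have h5 := (hW.mul_const (1 / 2)).mul ((hX.sub hY).norm_sq)
  refine ⟨_, (((h1.add h2).add h3).sub h4).add (h5.congr_of_eventuallyEq
    (Eventually.of_forall fun u => by simp [div_eq_mul_inv])), fun d => ?_⟩
  simp only [add_apply, sub_apply,
    ContinuousLinearMap.comp_apply, smul_apply, fderivInnerCLM_apply,
    ContinuousLinearMap.prod_apply, zero_apply, inner_zero_left, innerSL_apply_apply,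
    inner_sub_left, inner_add_left, real_inner_smul_left, ContinuousLinearMap.adjoint_inner_left,
    smul_eq_mul, ← inner_gradient_left, Function.comp_apply, inner_sub_right]
  simp [inner_sub_left, inner_sub_right, real_inner_comm]
  ring

end Derivatives

/-! ### The lifted space and explicit regular subgradients of the potential. -/

section Lifted

variable {n : ℕ}

/-- The point `(a, b, c, d)` of the lifted space. -/
def lift (a b c : EuclideanSpace ℝ (Fin n)) (d : ℝ) : LiftedSpace n :=
  WithLp.toLp 2 (a, WithLp.toLp 2 (b, WithLp.toLp 2 (c, d)))

theorem inner_lift (a b c : EuclideanSpace ℝ (Fin n)) (d : ℝ) (z : LiftedSpace n) :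
    inner ℝ (lift a b c d) z = inner ℝ a z.fst + inner ℝ b z.snd.fst + inner ℝ c z.snd.snd.fst
      + d * z.snd.snd.snd := by
  rw [lift, WithLp.prod_inner_apply, WithLp.prod_inner_apply, WithLp.prod_inner_apply]
  simp only [add_assoc]
  congr 3
  exact mul_comm _ _

theorem norm_toLp_prod_le {E F : Type*} [NormedAddCommGroup E] [NormedAddCommGroup F] (a : E)
    (b : F) : ‖WithLp.toLp 2 (a, b)‖ ≤ ‖a‖ + ‖b‖ := by
  rw [WithLp.prod_norm_eq_of_L2]
  refine Real.sqrt_le_iff.2 ⟨by positivity, ?_⟩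
  change ‖a‖ ^ 2 + ‖b‖ ^ 2 ≤ _
  nlinarith [norm_nonneg a, norm_nonneg b]

theorem norm_lift_le (a b c : EuclideanSpace ℝ (Fin n)) (d : ℝ) :
    ‖lift a b c d‖ ≤ ‖a‖ + ‖b‖ + ‖c‖ + |d| := by
  have h1 := norm_toLp_prod_le a (WithLp.toLp 2 (b, WithLp.toLp 2 (c, d)))
  have h2 := norm_toLp_prod_le b (WithLp.toLp 2 (c, d))
  have h3 := norm_toLp_prod_le c d
  rw [Real.norm_eq_abs] at h3
  unfold lift
  linarith

variable {P₁ P₂ : EuclideanSpace ℝ (Fin n) → ℝ}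

theorem le_qLifted (c x y ζ : EuclideanSpace ℝ (Fin n)) (w : ℝ) :
    ((P₁ y + inner ℝ (gradient P₁ y) (x - y) + (inner ℝ c ζ - P₂ c) - inner ℝ ζ x
      + w / 2 * ‖x - y‖ ^ 2 : ℝ) : EReal) ≤ qLifted P₁ P₂ x y ζ w := by
  rw [EReal.coe_add, EReal.coe_sub, EReal.coe_add (P₁ y + _)]
  exact add_le_add_left (EReal.sub_le_sub (add_le_add_right (le_conjugate P₂ c ζ) _) le_rfl) _

/-- In the equality case of Fenchel–Young the lifted constraint is exactly the constraint of the
subproblem, so the iterates lift to feasible points. -/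
theorem qLifted_eq {y ζ : EuclideanSpace ℝ (Fin n)} (hζ : ∀ z, P₂ y + inner ℝ ζ (z - y) ≤ P₂ z)
    (x : EuclideanSpace ℝ (Fin n)) (w : ℝ) :
    qLifted P₁ P₂ x y ζ w = (((P₁ y - P₂ y) + inner ℝ (gradient P₁ y - ζ) (x - y)
      + w / 2 * ‖x - y‖ ^ 2 : ℝ) : EReal) := by
  rw [qLifted, conjugate_eq hζ]
  norm_cast
  rw [inner_sub_left, inner_sub_right ζ, real_inner_comm ζ y]
  ring

variable {ρ : ℝ}

theorem potential_eq_ratio {z : LiftedSpace n}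
    (h1 : qLifted P₁ P₂ z.fst z.snd.fst z.snd.snd.fst z.snd.snd.snd ≤ 0) (h2 : ρ ≤ ‖z.fst‖) :
    potential P₁ P₂ ρ z = (ratio z.fst : EReal) := by
  simp [potential, delta, h1, h2]

theorem of_potential_ne_top {z : LiftedSpace n} (h : potential P₁ P₂ ρ z ≠ ⊤) :
    qLifted P₁ P₂ z.fst z.snd.fst z.snd.snd.fst z.snd.snd.snd ≤ 0 ∧ ρ ≤ ‖z.fst‖ := by
  by_contra hc
  rw [not_and_or] at hc
  apply h
  rcases hc with hc | hc
  · by_cases h2 : ρ ≤ ‖z.fst‖ <;> simp [potential, delta, hc, h2]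
  · by_cases h2 : qLifted P₁ P₂ z.fst z.snd.fst z.snd.snd.fst z.snd.snd.snd ≤ 0 <;>
      simp [potential, delta, hc, h2]

/-- The minorant is the affine minorant of the ℓ₁ norm over `‖x‖` plus `lam` times the minorant of
the lifted constraint. It lies below the potential since the latter constraint is nonpositive on the
domain, and it touches by complementarity. -/
theorem lift_mem_regularSubdiff_potential (hP : ContDiff ℝ 2 P₁) (hρ : 0 < ρ)
    {xt xn ζ s : EuclideanSpace ℝ (Fin n)} {l lam : ℝ}
    (hζ : ∀ z, P₂ xt + inner ℝ ζ (z - xt) ≤ P₂ z)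
    (hcon : (P₁ xt - P₂ xt) + inner ℝ (gradient P₁ xt - ζ) (xn - xt)
      + l / 2 * ‖xn - xt‖ ^ 2 ≤ 0)
    (hlam : 0 ≤ lam)
    (hcomp : lam * ((P₁ xt - P₂ xt) + inner ℝ (gradient P₁ xt - ζ) (xn - xt)
      + l / 2 * ‖xn - xt‖ ^ 2) = 0)
    (hn : ρ ≤ ‖xn‖) (hs : ∀ y, l1norm xn + inner ℝ s (y - xn) ≤ l1norm y) :
    lift (‖xn‖⁻¹ • s - (l1norm xn / ‖xn‖ ^ 3) • xn
          + lam • (gradient P₁ xt - ζ + l • (xn - xt)))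
        (lam • (ContinuousLinearMap.adjoint (fderiv ℝ (gradient P₁) xt) (xn - xt)
          - l • (xn - xt)))
        (lam • (xt - xn)) (lam * (‖xn - xt‖ ^ 2 / 2))
      ∈ regularSubdiff (potential P₁ P₂ ρ) (lift xn xt ζ l) := by
  have hn0 : xn ≠ 0 := norm_pos_iff.1 (hρ.trans_le hn)
  let X : LiftedSpace n →L[ℝ] EuclideanSpace ℝ (Fin n) := WithLp.fstL 2 ℝ _ _
  let T : LiftedSpace n →L[ℝ] WithLp 2 (EuclideanSpace ℝ (Fin n) ×
    WithLp 2 (EuclideanSpace ℝ (Fin n) × ℝ)) := WithLp.sndL 2 ℝ _ _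
  let Y : LiftedSpace n →L[ℝ] EuclideanSpace ℝ (Fin n) := (WithLp.fstL 2 ℝ _ _).comp T
  let T' : LiftedSpace n →L[ℝ] WithLp 2 (EuclideanSpace ℝ (Fin n) × ℝ) :=
    (WithLp.sndL 2 ℝ _ _).comp T
  let Z : LiftedSpace n →L[ℝ] EuclideanSpace ℝ (Fin n) := (WithLp.fstL 2 ℝ _ _).comp T'
  let W : LiftedSpace n →L[ℝ] ℝ := (WithLp.sndL 2 ℝ _ _).comp T'
  obtain ⟨D, hD, hDeq⟩ := exists_hasFDerivAt_lifted hP X Y Z W xt (P₂ xt) (lift xn xt ζ l)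
  have hR := (hasFDerivAt_ratio_minorant (l1norm xn) s hn0).comp (lift xn xt ζ l)
    (X.hasFDerivAt (x := lift xn xt ζ l))
  have hΨ := hR.add (hD.const_mul lam)
  refine mem_regularSubdiff_of_hasFDerivAt hΨ (fun d => ?_) ?_ (Eventually.of_forall fun z => ?_)
  · rw [inner_lift]
    simp only [add_apply, smul_apply, ContinuousLinearMap.comp_apply, innerSL_apply_apply,
      smul_eq_mul, hDeq]
    change inner ℝ (‖xn‖⁻¹ • s - (l1norm xn / ‖xn‖ ^ 3) • xn) d.fst + lam *
      (inner ℝ (gradient P₁ xt - ζ + l • (xn - xt)) d.fst + inner ℝ (ContinuousLinearMap.adjoint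
        (fderiv ℝ (gradient P₁) xt) (xn - xt) - l • (xn - xt)) d.snd.fst
        + inner ℝ (xt - xn) d.snd.snd.fst + ‖xn - xt‖ ^ 2 / 2 * d.snd.snd.snd) = _
    rw [inner_add_left (_ - _) (lam • _), real_inner_smul_left _ _ lam,
      real_inner_smul_left _ _ lam, real_inner_smul_left _ _ lam]
    ring
  · rw [potential_eq_ratio (z := lift xn xt ζ l) (by
      change qLifted P₁ P₂ xn xt ζ l ≤ 0
      rw [qLifted_eq hζ]; exact_mod_cast hcon) hn, EReal.coe_eq_coe_iff]
    change ratio xn = (l1norm xn + inner ℝ s (xn - xn)) * ‖xn‖⁻¹ + lam *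
      (P₁ xt + inner ℝ (gradient P₁ xt) (xn - xt) + (inner ℝ xt ζ - P₂ xt) - inner ℝ ζ xn
        + l / 2 * ‖xn - xt‖ ^ 2)
    have : P₁ xt + inner ℝ (gradient P₁ xt) (xn - xt) + (inner ℝ xt ζ - P₂ xt) - inner ℝ ζ xn
        + l / 2 * ‖xn - xt‖ ^ 2 = (P₁ xt - P₂ xt) + inner ℝ (gradient P₁ xt - ζ) (xn - xt)
      + l / 2 * ‖xn - xt‖ ^ 2 := by
      rw [inner_sub_left, inner_sub_right ζ, real_inner_comm ζ xt]; ring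
    rw [this, hcomp, sub_self, inner_zero_right, add_zero, add_zero]; rfl
  · by_cases hz : potential P₁ P₂ ρ z = ⊤
    · rw [hz]; exact le_top
    obtain ⟨hz1, hz2⟩ := of_potential_ne_top hz
    rw [potential_eq_ratio hz1 hz2, EReal.coe_le_coe_iff]
    have h1 := (le_qLifted (P₁ := P₁) (P₂ := P₂) xt _ _ _ _).trans hz1
    rw [← EReal.coe_zero, EReal.coe_le_coe_iff] at h1
    have h2 : (l1norm xn + inner ℝ s (z.fst - xn)) * ‖z.fst‖⁻¹ ≤ ratio z.fst := by
      rw [ratio, div_eq_mul_inv]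
      exact mul_le_mul_of_nonneg_right (hs _) (by positivity)
    exact (add_le_add h2 (mul_nonpos_of_nonneg_of_nonpos hlam h1)).trans (add_zero _).le

theorem mem_regularSubdiff_ratio {x s : EuclideanSpace ℝ (Fin n)} (hx : x ≠ 0)
    (hs : ∀ y, l1norm x + inner ℝ s (y - x) ≤ l1norm y) :
    ‖x‖⁻¹ • s - (l1norm x / ‖x‖ ^ 3) • x ∈ regularSubdiff (fun y => (ratio y : EReal)) x := by
  refine mem_regularSubdiff_of_hasFDerivAt (hasFDerivAt_ratio_minorant (l1norm x) s hx)
    (fun y => innerSL_apply_apply ..) (by simp [ratio, div_eq_mul_inv])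
    (Eventually.of_forall fun y => ?_)
  rw [EReal.coe_le_coe_iff, ratio, div_eq_mul_inv]
  exact mul_le_mul_of_nonneg_right (hs _) (by positivity)

end Lifted

/-! ### Calculus of desingularizing functions. -/

section Desingularizing

theorem IsDesingularizing.differentiableAt {a : EReal} {φ : ℝ → ℝ} (h : IsDesingularizing a φ)
    {s : ℝ} (h0 : 0 < s) (ha : (s : EReal) < a) : DifferentiableAt ℝ φ s := by
  have hopen : IsOpen {s : ℝ | 0 < s ∧ (s : EReal) < a} :=
    isOpen_Ioi.inter (isOpen_Iio.preimage continuous_coe_real_ereal)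
  exact (h.contDiffOn.contDiffAt (hopen.mem_nhds ⟨h0, ha⟩)).differentiableAt (by norm_num)

theorem IsDesingularizing.mono {a b : EReal} {φ : ℝ → ℝ} (h : IsDesingularizing b φ)
    (hab : a ≤ b) : IsDesingularizing a φ where
  zero := h.zero
  nonneg s h0 ha := h.nonneg s h0 (ha.trans_le hab)
  continuousOn := h.continuousOn.mono fun _ hs => ⟨hs.1, hs.2.trans_le hab⟩
  concaveOn := by
    refine h.concaveOn.subset (fun _ hs => ⟨hs.1, hs.2.trans_le hab⟩) (OrdConnected.convex ⟨?_⟩)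
    exact fun x hx y hy z hz =>
      ⟨hx.1.trans hz.1, (EReal.coe_le_coe_iff.2 hz.2).trans_lt hy.2⟩
  contDiffOn := h.contDiffOn.mono fun _ hs => ⟨hs.1, hs.2.trans_le hab⟩
  deriv_pos s h0 ha := h.deriv_pos s h0 (ha.trans_le hab)

theorem IsDesingularizing.deriv_add {a : EReal} {φ ψ : ℝ → ℝ} (hφ : IsDesingularizing a φ)
    (hψ : IsDesingularizing a ψ) {s : ℝ} (h0 : 0 < s) (ha : (s : EReal) < a) :
    deriv (φ + ψ) s = deriv φ s + deriv ψ s :=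
  _root_.deriv_add (hφ.differentiableAt h0 ha) (hψ.differentiableAt h0 ha)

theorem IsDesingularizing.add {a : EReal} {φ ψ : ℝ → ℝ} (hφ : IsDesingularizing a φ)
    (hψ : IsDesingularizing a ψ) : IsDesingularizing a (φ + ψ) where
  zero := by simp [hφ.zero, hψ.zero]
  nonneg s h0 ha := add_nonneg (hφ.nonneg s h0 ha) (hψ.nonneg s h0 ha)
  continuousOn := hφ.continuousOn.add hψ.continuousOn
  concaveOn := hφ.concaveOn.add hψ.concaveOn
  contDiffOn := hφ.contDiffOn.add hψ.contDiffOn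
  deriv_pos s h0 ha := by
    rw [hφ.deriv_add hψ h0 ha]
    exact add_pos (hφ.deriv_pos s h0 ha) (hψ.deriv_pos s h0 ha)

theorem IsDesingularizing.deriv_mul_le {a : EReal} {φ : ℝ → ℝ} (h : IsDesingularizing a φ)
    {s r : ℝ} (hr : 0 ≤ r) (hrs : r ≤ s) (hs : 0 < s) (ha : (s : EReal) < a) :
    deriv φ s * (s - r) ≤ φ s - φ r := by
  rcases hrs.eq_or_lt with rfl | hlt
  · simp
  have := h.concaveOn.deriv_le_slope (x := r) (y := s)
    ⟨hr, (EReal.coe_lt_coe_iff.2 hlt).trans ha⟩ ⟨hs.le, ha⟩ hlt (h.differentiableAt hs ha)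
  rw [slope_def_field, le_div_iff₀ (by linarith)] at this
  exact this

end Desingularizing

/-! ### One KL inequality along a relatively compact sequence. -/

section Uniformization

variable {E : Type*} [NormedAddCommGroup E] [InnerProductSpace ℝ E]

/-- The KL inequality holds eventually along a sequence in a compact set, with one desingularizing
function from a class closed under addition. -/
theorem exists_uniform_KL {h : E → EReal} {z : ℕ → E} {r : ℕ → ℝ} {c : ℝ} {K : Set E}
    (hK : IsCompact K) (hzK : ∀ t, z t ∈ K) (hz : ∀ t, h (z t) = r t)
    (hr : Tendsto r atTop (𝓝 c)) (S : Set (ℝ → ℝ)) (hS : ∀ φ ∈ S, ∀ ψ ∈ S, φ + ψ ∈ S)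
    (hKL : ∀ x, MapClusterPt x atTop z → h x = c ∧ ∃ (a : EReal), ∃ φ ∈ S, 0 < a ∧
      IsDesingularizing a φ ∧ KLInequality h x a φ) :
    ∃ (a : EReal), ∃ φ ∈ S, 0 < a ∧ IsDesingularizing a φ ∧ ∀ᶠ t in atTop, c < r t →
      1 ≤ ENNReal.ofReal (deriv φ (r t - c)) *
        Metric.infEDist (0 : E) (limitingSubdiff h (z t)) := by
  have hsmall : ∀ a : EReal, 0 < a → ∀ᶠ t in atTop, ((r t - c : ℝ) : EReal) < a := by
    intro a ha
    have h1 : Tendsto (fun t => ((r t - c : ℝ) : EReal)) atTop (𝓝 ((0 : ℝ) : EReal)) := by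
      rw [EReal.tendsto_coe]
      simpa using hr.sub_const c
    exact h1.eventually (gt_mem_nhds (by simpa using ha))
  suffices H : ∃ (a : EReal), ∃ φ ∈ S, 0 < a ∧ IsDesingularizing a φ ∧ ∀ᶠ t in atTop, z t ∈ K →
      c < r t → 1 ≤ ENNReal.ofReal (deriv φ (r t - c)) *
        Metric.infEDist (0 : E) (limitingSubdiff h (z t)) by
    obtain ⟨a, φ, hφ, ha, hd, hev⟩ := H
    exact ⟨a, φ, hφ, ha, hd, hev.mono fun t ht => ht (hzK t)⟩
  refine hK.induction_on (p := fun A => ∃ (a : EReal), ∃ φ ∈ S, 0 < a ∧ IsDesingularizing a φ ∧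
    ∀ᶠ t in atTop, z t ∈ A → c < r t → 1 ≤ ENNReal.ofReal (deriv φ (r t - c)) *
        Metric.infEDist (0 : E) (limitingSubdiff h (z t))) ?_ ?_ ?_ ?_
  · obtain ⟨x, -, hx⟩ := hK.exists_mapClusterPt_of_frequently (l := atTop) (f := z)
      (Frequently.of_forall hzK)
    obtain ⟨-, a, φ, hφ, ha, hd, -⟩ := hKL x hx
    exact ⟨a, φ, hφ, ha, hd, by simp⟩
  · rintro A B hAB ⟨a, φ, hφ, ha, hd, hev⟩
    exact ⟨a, φ, hφ, ha, hd, hev.mono fun t ht hA => ht (hAB hA)⟩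
  · rintro A B ⟨a, φ, hφ, ha, hd, hev⟩ ⟨b, ψ, hψ, hb, he, hev'⟩
    have hd' := hd.mono (min_le_left a b)
    have he' := he.mono (min_le_right a b)
    -- The sum serves both pieces: derivatives are positive, so its derivative dominates each
    -- summand's, and an inequality with a larger derivative is weaker.
    refine ⟨min a b, φ + ψ, hS φ hφ ψ hψ, lt_min ha hb, hd'.add he', ?_⟩
    filter_upwards [hev, hev', hsmall _ (lt_min ha hb)] with t h1 h2 h3 hAB hc
    have h0 : 0 < r t - c := sub_pos.2 hc
    rw [hd'.deriv_add he' h0 h3]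
    have p1 := hd'.deriv_pos _ h0 h3
    have p2 := he'.deriv_pos _ h0 h3
    rcases hAB with hA | hB
    · exact (h1 hA hc).trans (mul_le_mul_left (ENNReal.ofReal_le_ofReal (by linarith)) _)
    · exact (h2 hB hc).trans (mul_le_mul_left (ENNReal.ofReal_le_ofReal (by linarith)) _)
  · intro x hx
    by_cases hcl : MapClusterPt x atTop z
    · obtain ⟨hxc, a, φ, hφ, ha, hd, U, hU, hineq⟩ := hKL x hcl
      refine ⟨U, mem_nhdsWithin_of_mem_nhds hU, a, φ, hφ, ha, hd, ?_⟩
      filter_upwards [hsmall a ha] with t ht hzU hc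
      have := hineq (z t) hzU (by rw [hxc, hz]; exact_mod_cast hc) (by
        rw [hxc, hz, add_comm]
        rw [EReal.coe_sub] at ht
        exact (EReal.sub_lt_iff (by simp) (by simp)).1 ht)
      rwa [hz, hxc, ← EReal.coe_sub, EReal.toReal_coe] at this
    -- Near a point that is not a cluster point the sequence eventually has no terms, so any
    -- admissible `φ` works; one is borrowed from an actual cluster point.
    · rw [mapClusterPt_iff_frequently] at hcl
      push Not at hcl
      obtain ⟨U, hU, hev⟩ := hcl
      obtain ⟨y, -, hy⟩ := hK.exists_mapClusterPt_of_frequently (l := atTop) (f := z)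
        (Frequently.of_forall hzK)
      obtain ⟨-, a, φ, hφ, ha, hd, -⟩ := hKL y hy
      refine ⟨U, mem_nhdsWithin_of_mem_nhds hU, a, φ, hφ, ha, hd, ?_⟩
      filter_upwards [hev] with t ht hzU
      exact absurd hzU ht

end Uniformization

/-! ### Finite length from decrease and the KL inequality. -/

section Length

variable {E : Type*} [NormedAddCommGroup E]

/-- Finite length of a sequence with sufficient decrease and the KL inequality. -/
theorem exists_limit_of_KL [CompleteSpace E] {x : ℕ → E} {b : ℕ → ℝ} {c C : ℝ} {a : EReal}
    {φ : ℝ → ℝ} {T : ℕ} (hc : 0 < c) (hC : 0 ≤ C) (hφ : IsDesingularizing a φ)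
    (hb0 : ∀ t, 0 ≤ b t) (hba : ∀ t ≥ T, (b t : EReal) < a)
    (hdec : ∀ t, b (t + 1) + c * ‖x (t + 2) - x (t + 1)‖ ^ 2 ≤ b t)
    (hKL : ∀ t ≥ T, 0 < b t → 1 ≤ deriv φ (b t) * (C * ‖x (t + 1) - x t‖)) :
    ∃ xstar, Tendsto x atTop (𝓝 xstar) ∧
      ∀ t ≥ T, ‖x (t + 1) - xstar‖ ≤ ‖x (t + 1) - x t‖ + C / c * φ (b t) := by
  have step : ∀ t ≥ T, 2 * ‖x (t + 2) - x (t + 1)‖ ≤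
      ‖x (t + 1) - x t‖ + C / c * (φ (b t) - φ (b (t + 1))) := by
    intro t ht
    set d := ‖x (t + 1) - x t‖ with hd
    set d' := ‖x (t + 2) - x (t + 1)‖ with hd'
    have d0 : 0 ≤ d := norm_nonneg _
    have d0' : 0 ≤ d' := norm_nonneg _
    have h1 := hdec t
    rcases (hb0 t).eq_or_lt with h0 | h0
    · have h2 := hb0 (t + 1)
      have h3 : b (t + 1) = 0 := by nlinarith [mul_nonneg hc.le (sq_nonneg d')]
      have h4 : c * d' ^ 2 ≤ 0 := by linarith
      have h5 : d' = 0 := by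
        by_contra hne
        have : 0 < c * d' ^ 2 := by positivity
        linarith
      rw [h5, h3, ← h0]; simpa using d0
    · have h2 := hKL t ht h0
      have hle : b (t + 1) ≤ b t := by nlinarith [mul_nonneg hc.le (sq_nonneg d')]
      have h3 := hφ.deriv_mul_le (hb0 (t + 1)) hle h0 (hba t ht)
      have h4 := hφ.deriv_pos _ h0 (hba t ht)
      set Δ := φ (b t) - φ (b (t + 1)) with hΔ
      -- Concavity gives `deriv φ (b t) * (b t - b (t + 1)) ≤ Δ`; multiplying the decrease by the KL
      -- inequality cancels the derivative.
      have h5 : c * d' ^ 2 ≤ C * d * Δ := by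
        have e1 : deriv φ (b t) * (c * d' ^ 2) ≤ Δ :=
          (mul_le_mul_of_nonneg_left (by linarith) h4.le).trans h3
        have e2 : 0 ≤ c * d' ^ 2 := by positivity
        calc c * d' ^ 2 = 1 * (c * d' ^ 2) := (one_mul _).symm
          _ ≤ deriv φ (b t) * (C * d) * (c * d' ^ 2) := mul_le_mul_of_nonneg_right h2 e2
          _ = C * d * (deriv φ (b t) * (c * d' ^ 2)) := by ring
          _ ≤ _ := mul_le_mul_of_nonneg_left e1 (by positivity)
      have hΔ0 : 0 ≤ Δ := le_trans (mul_nonneg h4.le (by linarith)) h3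
      have h6 : d' ^ 2 ≤ d * (C / c * Δ) := by
        have : d * (C / c * Δ) = (C * d * Δ) / c := by field_simp
        rw [this, le_div_iff₀ hc]; linarith
      have h7 : 0 ≤ C / c * Δ := by positivity
      -- Arithmetic–geometric mean: `d' ^ 2 ≤ d * e` implies `2 * d' ≤ d + e`.
      refine abs_le_of_sq_le_sq' ?_ (by positivity) |>.2
      nlinarith [sq_nonneg (d - C / c * Δ)]
  have hφ0 : ∀ t ≥ T, 0 ≤ C / c * φ (b t) := fun t ht =>
    mul_nonneg (by positivity) (hφ.nonneg _ (hb0 t) (hba t ht))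
  have sum : ∀ t ≥ T, ∀ N, ∑ i ∈ Finset.range N, ‖x (t + 1 + i + 1) - x (t + 1 + i)‖ ≤
      ‖x (t + 1) - x t‖ + C / c * φ (b t) := by
    intro t ht N
    -- The last step length and the last value of `φ` are kept on the left so that the estimate
    -- telescopes under induction.
    have : ∑ i ∈ Finset.range N, ‖x (t + 1 + i + 1) - x (t + 1 + i)‖ +
        ‖x (t + N + 1) - x (t + N)‖ + C / c * φ (b (t + N)) ≤
      ‖x (t + 1) - x t‖ + C / c * φ (b t) := by
      induction N with
      | zero => simp
      | succ N ih =>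
        rw [Finset.sum_range_succ]
        have := step (t + N) (by omega)
        rw [show t + 1 + N = t + N + 1 by ring, show t + (N + 1) = t + N + 1 by ring,
          show t + N + 1 + 1 = t + N + 2 by ring]
        linarith
    have h1 := hφ0 (t + N) (by omega)
    have h2 := norm_nonneg (x (t + N + 1) - x (t + N))
    linarith
  have hdist : ∀ t N, ‖x (t + N) - x t‖ ≤ ∑ i ∈ Finset.range N, ‖x (t + i + 1) - x (t + i)‖ := by
    intro t N
    induction N with
    | zero => simp
    | succ N ih =>
      rw [Finset.sum_range_succ]
      have := norm_sub_le_norm_sub_add_norm_sub (x (t + N + 1)) (x (t + N)) (x t)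
      rw [show t + (N + 1) = t + N + 1 by ring]
      linarith
  have hsum : Summable fun i => dist (x (T + 1 + i)) (x (T + 1 + i + 1)) := by
    refine summable_of_sum_range_le (fun _ => dist_nonneg) fun N => le_trans (le_of_eq ?_)
      (sum T le_rfl N)
    exact Finset.sum_congr rfl fun i _ => dist_eq_norm' _ _
  have hcau : CauchySeq fun i => x (T + 1 + i) := cauchySeq_of_summable_dist hsum
  obtain ⟨xstar, hlim⟩ := cauchySeq_tendsto_of_complete hcau
  have hlim : Tendsto x atTop (𝓝 xstar) := by
    simp only [add_comm (T + 1)] at hlim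
    exact (tendsto_add_atTop_iff_nat (T + 1)).1 hlim
  refine ⟨xstar, hlim, fun t ht => ?_⟩
  have hl : Tendsto (fun N => ‖x (t + 1) - x (t + 1 + N)‖) atTop (𝓝 ‖x (t + 1) - xstar‖) := by
    refine ((hlim.comp (tendsto_add_atTop_nat (t + 1))).const_sub _).norm.congr fun N => ?_
    simp [add_comm]
  refine le_of_tendsto' hl fun N => ?_
  rw [norm_sub_rev]
  exact (hdist _ _).trans (sum t ht N)

end Length

/-! ### Convergence rates from scalar recursions. -/

section Rates

variable {E : Type*} [NormedAddCommGroup E]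

/-- With a linear desingularizing function the KL inequality bounds the steps away from zero while
the gap is positive. Since the steps vanish, the gap must reach zero, after which nothing moves. -/
theorem eventually_eq_of_exponent_zero {x : ℕ → E} {xstar : E} {b : ℕ → ℝ} {A B : ℝ}
    {T : ℕ} (hx : Tendsto x atTop (𝓝 xstar)) (hb0 : ∀ t, 0 ≤ b t)
    (hanti : Antitone b)
    (hdec : ∀ t, b t = 0 → x (t + 2) = x (t + 1))
    (hbd : ∀ t ≥ T, ‖x (t + 1) - xstar‖ ≤ ‖x (t + 1) - x t‖ + B * b t)
    (hKL : ∀ t ≥ T, 0 < b t → 1 ≤ A * ‖x (t + 1) - x t‖) :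
    ∃ T' : ℕ, ∀ t ≥ T', x t = xstar := by
  have hd : Tendsto (fun t => A * ‖x (t + 1) - x t‖) atTop (𝓝 0) := by
    simpa using (((hx.comp (tendsto_add_atTop_nat 1)).sub hx).norm).const_mul A
  obtain ⟨t₀, ht₀, hlt⟩ := ((eventually_ge_atTop T).and
    (hd.eventually (gt_mem_nhds one_pos))).exists
  have hbt : b t₀ = 0 := by
    by_contra hne
    exact absurd (hKL t₀ ht₀ (lt_of_le_of_ne (hb0 _) (Ne.symm hne))) (not_le.2 hlt)
  have hz : ∀ t ≥ t₀, b t = 0 := fun t ht => le_antisymm ((hanti ht).trans hbt.le) (hb0 t)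
  refine ⟨t₀ + 2, fun t ht => ?_⟩
  obtain ⟨k, rfl⟩ := Nat.exists_eq_add_of_le ht
  have h1 := hbd (t₀ + k + 1) (by omega)
  have h2 := hdec (t₀ + k) (hz _ (by omega))
  rw [show t₀ + k + 1 + 1 = t₀ + k + 2 by ring, h2, hz (t₀ + k + 1) (by omega)] at h1
  rw [show t₀ + 2 + k = t₀ + k + 2 by ring, h2, ← sub_eq_zero, ← norm_le_zero_iff]
  simpa using h1

theorem norm_sub_le_sqrt_add {x : ℕ → E} {xstar : E} {b : ℕ → ℝ} {c B θ : ℝ} {T : ℕ} (hc : 0 < c)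
    (hB : 0 ≤ B) (hθ : θ ≤ 1) (hb0 : ∀ t, 0 ≤ b t)
    (hdec : ∀ t, b (t + 1) + c * ‖x (t + 2) - x (t + 1)‖ ^ 2 ≤ b t)
    (hbd : ∀ t ≥ T, ‖x (t + 1) - xstar‖ ≤ ‖x (t + 1) - x t‖ + B * b t ^ (1 - θ))
    (t : ℕ) (ht : T ≤ t) :
    ‖x (t + 2) - xstar‖ ≤ (√c)⁻¹ * b t ^ (1 / 2 : ℝ) + B * b t ^ (1 - θ) := by
  have h1 := hdec t
  have h2 := hbd (t + 1) (by omega)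
  rw [show t + 1 + 1 = t + 2 by ring] at h2
  have h3 : b (t + 1) ≤ b t := by nlinarith [sq_nonneg ‖x (t + 2) - x (t + 1)‖]
  have h4 : ‖x (t + 2) - x (t + 1)‖ ≤ (√c)⁻¹ * b t ^ (1 / 2 : ℝ) := by
    rw [← Real.sqrt_eq_rpow, ← Real.sqrt_inv, ← Real.sqrt_mul (by positivity)]
    refine Real.le_sqrt_of_sq_le ?_
    rw [inv_mul_eq_div, le_div_iff₀ hc]
    linarith [hb0 (t + 1)]
  have h5 : b (t + 1) ^ (1 - θ) ≤ b t ^ (1 - θ) :=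
    Real.rpow_le_rpow (hb0 _) h3 (by linarith)
  have := mul_le_mul_of_nonneg_left h5 hB
  linarith

/-- The KL inequality reads `b ^ θ ≤ A * d`. Its square, taken at the new index, is inserted into
the decrease, leaving a recursion in `b` alone. -/
theorem decrease_of_exponent {b d : ℕ → ℝ} {A c θ : ℝ} {T : ℕ} (hA : 0 < A) (hθ : 0 < θ)
    (hc : 0 < c) (hb0 : ∀ t, 0 ≤ b t) (hd : ∀ t, 0 ≤ d t)
    (hdec : ∀ t, b (t + 1) + c * d (t + 1) ^ 2 ≤ b t)
    (hKL : ∀ t ≥ T, 0 < b t → 1 ≤ A * b t ^ (-θ) * d t) (t : ℕ) (ht : T ≤ t) :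
    b (t + 1) + c / A ^ 2 * b (t + 1) ^ (2 * θ) ≤ b t := by
  have h1 : b (t + 1) ^ θ ≤ A * d (t + 1) := by
    rcases (hb0 (t + 1)).eq_or_lt with h0 | h0
    · rw [← h0, Real.zero_rpow hθ.ne']; exact mul_nonneg hA.le (hd _)
    · have h2 := hKL (t + 1) (by omega) h0
      have h3 : 0 < b (t + 1) ^ θ := Real.rpow_pos_of_pos h0 θ
      rw [Real.rpow_neg h0.le] at h2
      calc b (t + 1) ^ θ = b (t + 1) ^ θ * 1 := (mul_one _).symm
        _ ≤ b (t + 1) ^ θ * (A * (b (t + 1) ^ θ)⁻¹ * d (t + 1)) :=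
          mul_le_mul_of_nonneg_left h2 h3.le
        _ = _ := by field_simp
  have h2 : b (t + 1) ^ (2 * θ) ≤ (A * d (t + 1)) ^ 2 := by
    rw [mul_comm, Real.rpow_mul (hb0 _), Real.rpow_two]
    exact pow_le_pow_left₀ (Real.rpow_nonneg (hb0 _) _) h1 2
  have h3 : c / A ^ 2 * b (t + 1) ^ (2 * θ) ≤ c * d (t + 1) ^ 2 := by
    calc _ ≤ c / A ^ 2 * (A * d (t + 1)) ^ 2 := by gcongr
      _ = _ := by field_simp
  linarith [hdec t]

theorem le_geometric_of_decrease {b : ℕ → ℝ} {m : ℝ} {T : ℕ} (hm : 0 < m)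
    (h : ∀ t ≥ T, b (t + 1) + m * b (t + 1) ≤ b t) (k : ℕ) :
    b (T + k) ≤ b T * (1 / (1 + m)) ^ k := by
  induction k with
  | zero => simp
  | succ k ih =>
    have h1 := h (T + k) (by omega)
    rw [pow_succ, ← mul_assoc, mul_one_div, le_div_iff₀ (by linarith)]
    rw [show T + (k + 1) = T + k + 1 by ring]
    linarith

/-- The recursion makes `b ^ (-γ)` grow at least linearly. The product form of the conclusion also
allows `b` to vanish. -/
theorem rpow_le_inv_of_decrease {b : ℕ → ℝ} {m γ : ℝ} {T : ℕ} (hm : 0 < m) (hγ : 0 < γ)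
    (hγ1 : γ ≤ 1) (hb0 : ∀ t, 0 ≤ b t) (hb1 : ∀ t ≥ T, b t ≤ 1)
    (h : ∀ t ≥ T, b (t + 1) + m * b (t + 1) ^ (γ + 1) ≤ b t) :
    ∃ ν : ℝ, 0 < ν ∧ ∀ k : ℕ, b (T + k) ^ γ * (ν * k) ≤ 1 := by
  obtain ⟨μ, hμ⟩ : ∃ μ, μ = γ * m / (1 + m) := ⟨_, rfl⟩
  have hμ0 : 0 < μ := by rw [hμ]; positivity
  have hrec : ∀ t ≥ T, b (t + 1) ^ γ * (1 + μ * b (t + 1) ^ γ) ≤ b t ^ γ := by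
    intro t ht
    set u := b (t + 1) ^ γ with hu
    have hu0 : 0 ≤ u := Real.rpow_nonneg (hb0 _) _
    have hu1 : u ≤ 1 := Real.rpow_le_one (hb0 _) (hb1 _ (by omega)) hγ.le
    have h1 : b (t + 1) * (1 + m * u) ≤ b t := by
      have := h t ht
      rw [Real.rpow_add_one' (hb0 _) (by linarith), ← hu] at this
      linarith
    have hv0 : 0 ≤ m * u := by positivity
    have h2 : u * (1 + m * u) ^ γ ≤ b t ^ γ := by
      rw [hu, ← Real.mul_rpow (hb0 _) (by linarith)]
      exact Real.rpow_le_rpow (mul_nonneg (hb0 _) (by linarith)) h1 hγ.le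
    -- A lower Bernoulli bound for exponent `γ`, deduced from the upper one for `1 - γ` by splitting
    -- `1 + m * u` into two powers. The denominator in `μ = γ * m / (1 + m)` absorbs the cross term,
    -- using `u ≤ 1`.
    have h3 : 1 + μ * u ≤ (1 + m * u) ^ γ := by
      have e1 := rpow_one_add_le_one_add_mul_self (s := m * u) (p := 1 - γ) (by linarith)
        (by linarith) (by linarith)
      have e2 : (1 + m * u) ^ γ * (1 + m * u) ^ (1 - γ) = 1 + m * u := by
        rw [← Real.rpow_add (by linarith)]; simp
      have e3 : 0 < (1 + m * u) ^ γ := Real.rpow_pos_of_pos (by linarith) _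
      have e4 : 1 + m * u ≤ (1 + m * u) ^ γ * (1 + (1 - γ) * (m * u)) := by
        calc 1 + m * u = _ := e2.symm
          _ ≤ _ := by gcongr
      have e5 : (1 + μ * u) * (1 + (1 - γ) * (m * u)) ≤ 1 + m * u := by
        have e6 : μ * (1 + m) = γ * m := by rw [hμ]; field_simp
        have e7 : μ * u * ((1 - γ) * (m * u)) ≤ μ * u * m := by
          have : (1 - γ) * (m * u) ≤ 1 * (m * 1) := by gcongr; linarith
          have : 0 ≤ μ * u := by positivity
          nlinarith
        nlinarith
      have e8 : 0 < 1 + (1 - γ) * (m * u) := by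
        have : 0 ≤ (1 - γ) * (m * u) := mul_nonneg (by linarith) hv0
        linarith
      exact le_of_mul_le_mul_right (e5.trans e4) e8
    exact (mul_le_mul_of_nonneg_left h3 hu0).trans h2
  -- This `ν` satisfies `μ - ν = μ * ν`, so `(1 - u * ν) * (1 + μ * u) - 1` equals `u * (μ * ν * (1
  -- - u))`, which is nonnegative for `u ≤ 1`.
  refine ⟨μ / (1 + μ), by positivity, fun k => ?_⟩
  obtain ⟨ν, hν⟩ : ∃ ν, ν = μ / (1 + μ) := ⟨_, rfl⟩
  have hν0 : 0 < ν := by rw [hν]; positivity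
  have hνμ : μ - ν = μ * ν := by rw [hν]; field_simp; ring
  rw [← hν]
  induction k with
  | zero => simp
  | succ k ih =>
    have h1 := hrec (T + k) (by omega)
    rw [show T + (k + 1) = T + k + 1 by ring]
    have hu0 : 0 ≤ b (T + k + 1) ^ γ := Real.rpow_nonneg (hb0 _) _
    have hu1 : b (T + k + 1) ^ γ ≤ 1 := Real.rpow_le_one (hb0 _) (hb1 _ (by omega)) hγ.le
    set u := b (T + k + 1) ^ γ with hu
    have h2 : u * (1 + μ * u) * (ν * k) ≤ 1 :=
      (mul_le_mul_of_nonneg_right h1 (by positivity)).trans ih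
    push_cast
    by_contra! hlt
    have hupos : 0 < u := by
      rcases hu0.eq_or_lt with h0 | h0
      · rw [← h0] at hlt; norm_num at hlt
      · exact h0
    have h3 : 1 - u * ν < u * (ν * k) := by linarith
    have h4 : (1 - u * ν) * (1 + μ * u) < 1 := by
      have : 0 < 1 + μ * u := by positivity
      nlinarith
    have h5 : u * (μ * ν * (1 - u)) < 0 := by
      have : (1 - u * ν) * (1 + μ * u) - 1 = u * ((μ - ν) - μ * ν * u) := by ring
      rw [hνμ] at this
      nlinarith
    have h6 : 0 ≤ u * (μ * ν * (1 - u)) :=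
      mul_nonneg hu0 (mul_nonneg (by positivity) (by linarith))
    linarith

theorem linear_rate {x : ℕ → E} {xstar : E} {b : ℕ → ℝ} {A B c θ : ℝ} {T : ℕ} (hA : 0 < A)
    (hB : 0 ≤ B) (hc : 0 < c) (hθ : 0 < θ) (hθ1 : θ ≤ 1 / 2) (hb0 : ∀ t, 0 ≤ b t)
    (hb : Tendsto b atTop (𝓝 0))
    (hdec : ∀ t, b (t + 1) + c * ‖x (t + 2) - x (t + 1)‖ ^ 2 ≤ b t)
    (hbd : ∀ t ≥ T, ‖x (t + 1) - xstar‖ ≤ ‖x (t + 1) - x t‖ + B * b t ^ (1 - θ))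
    (hKL : ∀ t ≥ T, 0 < b t → 1 ≤ A * b t ^ (-θ) * ‖x (t + 1) - x t‖) :
    ∃ c₀ : ℝ, 0 < c₀ ∧ ∃ Q₁ : ℝ, 0 < Q₁ ∧ Q₁ < 1 ∧ ∃ T : ℕ, ∀ t > T,
      ‖x t - xstar‖ ≤ c₀ * Q₁ ^ t := by
  obtain ⟨T', hT'⟩ := eventually_atTop.1 ((eventually_ge_atTop T).and
    (hb.eventually (ge_mem_nhds one_pos)))
  obtain ⟨m, hm⟩ : ∃ m, m = c / A ^ 2 := ⟨_, rfl⟩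
  have hm0 : 0 < m := by rw [hm]; positivity
  have hgeo : ∀ k, b (T' + k) ≤ 1 * (1 / (1 + m)) ^ k := fun k => by
    refine (le_geometric_of_decrease hm0 (fun t ht => ?_) k).trans ?_
    · have h1 := decrease_of_exponent (d := fun t => ‖x (t + 1) - x t‖) hA hθ hc hb0
        (fun _ => norm_nonneg _) hdec hKL t (hT' t ht).1
      rw [← hm] at h1
      refine le_trans ?_ h1
      gcongr
      rcases (hb0 (t + 1)).eq_or_lt with h0 | h0
      · rw [← h0, Real.zero_rpow (by linarith)]
      · calc b (t + 1) = b (t + 1) ^ (1 : ℝ) := (Real.rpow_one _).symm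
          _ ≤ _ := Real.rpow_le_rpow_of_exponent_ge h0 (hT' (t + 1) (by omega)).2 (by linarith)
    · gcongr; exact (hT' T' le_rfl).2
  obtain ⟨q, hq⟩ : ∃ q, q = 1 / (1 + m) := ⟨_, rfl⟩
  have hq0 : 0 < q := by rw [hq]; positivity
  have hq1 : q < 1 := by rw [hq, div_lt_one (by linarith)]; linarith
  have hs0 : 0 < √q := Real.sqrt_pos.2 hq0
  have hD : 0 < (√c)⁻¹ + B := by have : 0 < (√c)⁻¹ := by positivity
                                 linarith
  -- Once `b ≤ 1`, both terms bounding the distance are at most multiples of `b ^ (1 / 2)`, because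
  -- `1 - θ ≥ 1 / 2`; hence the rate `√q`. The divisor compensates the index shift.
  refine ⟨((√c)⁻¹ + B) / √q ^ (T' + 2), by positivity, √q, hs0, ?_, T' + 2, fun t ht => ?_⟩
  · rw [Real.sqrt_lt' one_pos]; simpa using hq1
  obtain ⟨k, rfl⟩ := Nat.exists_eq_add_of_lt ht
  have h1 := norm_sub_le_sqrt_add hc hB (by linarith) hb0 hdec hbd (T' + (k + 1))
    (hT' _ (by omega)).1
  have h2 : b (T' + (k + 1)) ^ (1 / 2 : ℝ) ≤ √q ^ (k + 1) := by
    rw [← Real.sqrt_eq_rpow]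
    refine Real.sqrt_le_iff.2 ⟨by positivity, ?_⟩
    rw [← pow_mul, mul_comm, pow_mul, Real.sq_sqrt hq0.le]
    simpa [hq] using hgeo (k + 1)
  have h3 : b (T' + (k + 1)) ^ (1 - θ) ≤ b (T' + (k + 1)) ^ (1 / 2 : ℝ) := by
    rcases (hb0 (T' + (k + 1))).eq_or_lt with h0 | h0
    · rw [← h0, Real.zero_rpow (by linarith), Real.zero_rpow (by norm_num)]
    · exact Real.rpow_le_rpow_of_exponent_ge h0 (hT' _ (by omega)).2 (by linarith)
  rw [show T' + 2 + k + 1 = T' + (k + 1) + 2 by ring]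
  calc _ ≤ _ := h1
    _ ≤ (√c)⁻¹ * √q ^ (k + 1) + B * √q ^ (k + 1) := by gcongr; exact h3.trans h2
    _ = _ := by
      rw [show T' + (k + 1) + 2 = (T' + 2) + (k + 1) by ring, pow_add _ (T' + 2) (k + 1)]
      field_simp

theorem sublinear_rate {x : ℕ → E} {xstar : E} {b : ℕ → ℝ} {A B c θ : ℝ} {T : ℕ} (hA : 0 < A)
    (hB : 0 ≤ B) (hc : 0 < c) (hθ : 1 / 2 < θ) (hθ1 : θ < 1) (hb0 : ∀ t, 0 ≤ b t)
    (hb : Tendsto b atTop (𝓝 0))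
    (hdec : ∀ t, b (t + 1) + c * ‖x (t + 2) - x (t + 1)‖ ^ 2 ≤ b t)
    (hbd : ∀ t ≥ T, ‖x (t + 1) - xstar‖ ≤ ‖x (t + 1) - x t‖ + B * b t ^ (1 - θ))
    (hKL : ∀ t ≥ T, 0 < b t → 1 ≤ A * b t ^ (-θ) * ‖x (t + 1) - x t‖) :
    ∃ c₀ : ℝ, 0 < c₀ ∧ ∃ T : ℕ, ∀ t > T,
      ‖x t - xstar‖ ≤ c₀ * (t : ℝ) ^ (-((1 - θ) / (2 * θ - 1))) := by
  obtain ⟨T', hT'⟩ := eventually_atTop.1 ((eventually_ge_atTop T).and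
    (hb.eventually (ge_mem_nhds one_pos)))
  have hγ : 0 < 2 * θ - 1 := by linarith
  obtain ⟨ν, hν, hk⟩ := rpow_le_inv_of_decrease (b := b) (m := c / A ^ 2) (γ := 2 * θ - 1) (T := T')
    (by positivity) hγ (by linarith) hb0 (fun t ht => (hT' t ht).2) (fun t ht => by
      have := decrease_of_exponent (d := fun t => ‖x (t + 1) - x t‖) hA (by linarith) hc hb0
        (fun _ => norm_nonneg _) hdec hKL t (hT' t ht).1
      rwa [sub_add_cancel])
  obtain ⟨p, hp⟩ : ∃ p, p = (1 - θ) / (2 * θ - 1) := ⟨_, rfl⟩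
  have hp0 : 0 < p := by rw [hp]; exact div_pos (by linarith) hγ
  have hD : 0 < (√c)⁻¹ + B := by have : 0 < (√c)⁻¹ := by positivity
                                 linarith
  rw [← hp]
  -- Beyond `2 * (T' + 2)` one has `t ≤ 2 * k` for `k = t - (T' + 2)`, which accounts for the factor
  -- `ν / 2`.
  refine ⟨((√c)⁻¹ + B) * (ν / 2) ^ (-p), by positivity, 2 * (T' + 2), fun t ht => ?_⟩
  obtain ⟨k, rfl⟩ : ∃ k, t = T' + k + 2 := ⟨t - (T' + 2), by omega⟩
  have hk0 : (0 : ℝ) < k := by exact_mod_cast (by omega : 0 < k)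
  have h1 := norm_sub_le_sqrt_add hc hB hθ1.le hb0 hdec hbd (T' + k) (hT' _ (by omega)).1
  have hbk := hb0 (T' + k)
  have h3 : b (T' + k) ^ (1 / 2 : ℝ) ≤ b (T' + k) ^ (1 - θ) := by
    rcases hbk.eq_or_lt with h0 | h0
    · rw [← h0, Real.zero_rpow (by norm_num : (1 / 2 : ℝ) ≠ 0), Real.zero_rpow (sub_pos.2 hθ1).ne']
    · exact Real.rpow_le_rpow_of_exponent_ge h0 (hT' _ (by omega)).2 (by linarith)
  have h4 : b (T' + k) ^ (1 - θ) ≤ (ν * k) ^ (-p) := by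
    have e1 : b (T' + k) ^ (2 * θ - 1) ≤ (ν * k)⁻¹ := by
      rw [← one_div, le_div_iff₀ (by positivity)]; exact hk k
    have e2 : b (T' + k) ^ (1 - θ) = (b (T' + k) ^ (2 * θ - 1)) ^ p := by
      rw [← Real.rpow_mul hbk, hp, mul_div_cancel₀ _ hγ.ne']
    rw [e2, Real.rpow_neg (by positivity), ← Real.inv_rpow (by positivity)]
    exact Real.rpow_le_rpow (Real.rpow_nonneg hbk _) e1 hp0.le
  have h5 : (ν * k) ^ (-p) ≤ (ν / 2) ^ (-p) * ((T' + k + 2 : ℕ) : ℝ) ^ (-p) := by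
    rw [← Real.mul_rpow (by positivity) (by positivity)]
    refine Real.rpow_le_rpow_of_nonpos (by positivity) ?_ (by linarith)
    have : ((T' + k + 2 : ℕ) : ℝ) ≤ 2 * k := by exact_mod_cast (by omega : T' + k + 2 ≤ 2 * k)
    nlinarith
  calc _ ≤ _ := h1
    _ ≤ (√c)⁻¹ * b (T' + k) ^ (1 - θ) + B * b (T' + k) ^ (1 - θ) := by gcongr
    _ = ((√c)⁻¹ + B) * b (T' + k) ^ (1 - θ) := by ring
    _ ≤ ((√c)⁻¹ + B) * ((ν / 2) ^ (-p) * ((T' + k + 2 : ℕ) : ℝ) ^ (-p)) := by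
      gcongr; exact h4.trans h5
    _ = _ := by ring

end Rates

/-! ### Boundedness properties of a run of the algorithm. -/

section Run

variable {n : ℕ}

/-- A bounded sequence of the algorithm under the standing assumptions on the problem. -/
structure IsBoundedRun (P₁ P₂ : EuclideanSpace ℝ (Fin n) → ℝ) (ρ α lmin lmax : ℝ) (L : NNReal)
    (M : ℝ) (x ζ : ℕ → EuclideanSpace ℝ (Fin n)) (lbar : ℕ → ℝ) : Prop where
  contDiff : ContDiff ℝ 2 P₁
  lipschitz : LipschitzWith L (gradient P₁)
  convexOn : ConvexOn ℝ univ P₂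
  continuous : Continuous P₂
  rho_pos : 0 < ρ
  lt_norm : ∀ y, P₁ y - P₂ y ≤ 0 → ρ < ‖y‖
  gmfcq : ∀ y, P₁ y - P₂ y = 0 →
    (0 : EuclideanSpace ℝ (Fin n)) ∉ clarkeSubdiff (fun z => P₁ z - P₂ z) y
  alpha_pos : 0 < α
  lmin_pos : 0 < lmin
  lmin_le : lmin ≤ lmax
  run : IsMBASequence P₁ P₂ α lmin lmax x ζ lbar
  norm_le : ∀ t, ‖x t‖ ≤ M

namespace IsBoundedRun

variable {P₁ P₂ : EuclideanSpace ℝ (Fin n) → ℝ} {ρ α lmin lmax : ℝ} {L : NNReal}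
    {M : ℝ} {x ζ : ℕ → EuclideanSpace ℝ (Fin n)} {lbar : ℕ → ℝ}

theorem differentiable (h : IsBoundedRun P₁ P₂ ρ α lmin lmax L M x ζ lbar) :
    Differentiable ℝ P₁ := h.contDiff.differentiable (by norm_num)

theorem subgradient (h : IsBoundedRun P₁ P₂ ρ α lmin lmax L M x ζ lbar) (t : ℕ)
    (y : EuclideanSpace ℝ (Fin n)) : P₂ (x t) + inner ℝ (ζ t) (y - x t) ≤ P₂ y :=
  ConvexOn.inner_le_of_mem_realSubdiff h.convexOn (h.run.subgradient t) y

theorem feasible (h : IsBoundedRun P₁ P₂ ρ α lmin lmax L M x ζ lbar) (t : ℕ) :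
    P₁ (x t) - P₂ (x t) ≤ 0 := by
  cases t with
  | zero => exact h.run.init
  | succ t =>
    obtain ⟨-, -, k, trial, -, -, hf, hn, -⟩ := h.run.step t
    rw [hn]; exact hf

theorem solves (h : IsBoundedRun P₁ P₂ ρ α lmin lmax L M x ζ lbar) (t : ℕ) :
    SolvesSubproblem P₁ P₂ α (x t) (ζ t) (lbar t) (x (t + 1)) := by
  obtain ⟨_, -, k, trial, hs, -, -, hn, hl⟩ := h.run.step t
  rw [hn, hl]; exact hs k le_rfl

theorem lbar_nonneg (h : IsBoundedRun P₁ P₂ ρ α lmin lmax L M x ζ lbar) (t : ℕ) :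
    0 ≤ lbar t := by
  obtain ⟨l₀, hl₀, k, trial, -, -, -, -, hl⟩ := h.run.step t
  have := h.lmin_pos.trans_le hl₀.1
  rw [hl]; positivity

/-- If the search doubled at least once, the preceding trial was infeasible at half the final value,
which must then be below `2 * L`. -/
theorem lbar_le (h : IsBoundedRun P₁ P₂ ρ α lmin lmax L M x ζ lbar) (t : ℕ) :
    lbar t ≤ lmax + 4 * L := by
  obtain ⟨l₀, hl₀, k, trial, hs, hf, -, -, hl⟩ := h.run.step t
  have hL : (0 : ℝ) ≤ L := L.coe_nonneg
  have hmax := h.lmin_pos.trans_le h.lmin_le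
  rw [hl]
  cases k with
  | zero => have := hl₀.2; simp; linarith
  | succ k =>
    by_contra! hlt
    refine hf k (by omega) ((hs k (by omega)).feasible h.differentiable h.lipschitz
      (h.subgradient t) ?_)
    rw [pow_succ] at hlt
    linarith

theorem lt_norm_x (h : IsBoundedRun P₁ P₂ ρ α lmin lmax L M x ζ lbar) (t : ℕ) : ρ < ‖x t‖ :=
  h.lt_norm _ (h.feasible t)

theorem x_ne_zero (h : IsBoundedRun P₁ P₂ ρ α lmin lmax L M x ζ lbar) (t : ℕ) : x t ≠ 0 :=
  norm_pos_iff.1 (h.rho_pos.trans (h.lt_norm_x t))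

theorem bound_pos (h : IsBoundedRun P₁ P₂ ρ α lmin lmax L M x ζ lbar) : 0 < M :=
  h.rho_pos.trans ((h.lt_norm_x 0).trans_le (h.norm_le 0))

theorem descent (h : IsBoundedRun P₁ P₂ ρ α lmin lmax L M x ζ lbar) (t : ℕ) :
    ratio (x (t + 1)) + α / (2 * M) * ‖x (t + 1) - x t‖ ^ 2 ≤ ratio (x t) :=
  (h.solves t).ratio_add_le (h.feasible t) (h.x_ne_zero t) (h.x_ne_zero _) (h.norm_le _)
    h.alpha_pos.le

theorem antitone_ratio (h : IsBoundedRun P₁ P₂ ρ α lmin lmax L M x ζ lbar) :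
    Antitone fun t => ratio (x t) :=
  antitone_nat_of_succ_le fun t => by
    have := h.descent t
    have h1 := h.bound_pos
    have h2 := h.alpha_pos
    have : 0 ≤ α / (2 * M) * ‖x (t + 1) - x t‖ ^ 2 := by positivity
    linarith

theorem exists_tendsto_ratio (h : IsBoundedRun P₁ P₂ ρ α lmin lmax L M x ζ lbar) :
    ∃ c, Tendsto (fun t => ratio (x t)) atTop (𝓝 c) ∧ ∀ t, c ≤ ratio (x t) := by
  have hbb : BddBelow (range fun t => ratio (x t)) :=
    ⟨0, by rintro _ ⟨t, rfl⟩; exact ratio_nonneg _⟩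
  exact ⟨_, tendsto_atTop_ciInf h.antitone_ratio hbb, fun t => ciInf_le hbb t⟩

theorem tendsto_norm_sub (h : IsBoundedRun P₁ P₂ ρ α lmin lmax L M x ζ lbar) :
    Tendsto (fun t => ‖x (t + 1) - x t‖) atTop (𝓝 0) := by
  obtain ⟨c, hc, -⟩ := h.exists_tendsto_ratio
  have hM := h.bound_pos
  have hα := h.alpha_pos
  have h1 : Tendsto (fun t => 2 * M / α * (ratio (x t) - ratio (x (t + 1)))) atTop (𝓝 0) := by
    simpa using (hc.sub (hc.comp (tendsto_add_atTop_nat 1))).const_mul (2 * M / α)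
  have h2 : Tendsto (fun t => ‖x (t + 1) - x t‖ ^ 2) atTop (𝓝 0) := by
    refine squeeze_zero (fun _ => by positivity) (fun t => ?_) h1
    have h3 := h.descent t
    have h4 : ‖x (t + 1) - x t‖ ^ 2 = 2 * M / α * (α / (2 * M) * ‖x (t + 1) - x t‖ ^ 2) := by
      field_simp
    rw [h4]
    gcongr
    linarith
  simpa [Real.sqrt_sq (norm_nonneg _)] using h2.sqrt

theorem exists_zeta_bound (h : IsBoundedRun P₁ P₂ ρ α lmin lmax L M x ζ lbar) :
    ∃ B, ∀ t, ‖ζ t‖ ≤ B := by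
  obtain ⟨B, hB⟩ := (isCompact_closedBall (0 : EuclideanSpace ℝ (Fin n))
    (M + 1)).exists_bound_of_continuousOn h.continuous.continuousOn
  exact ⟨2 * B, fun t => norm_subgradient_le (h.subgradient t) (R := M)
    (fun y hy => hB y (by simpa using hy)) (h.norm_le t)⟩

theorem sub_mem_clarkeSubdiff (h : IsBoundedRun P₁ P₂ ρ α lmin lmax L M x ζ lbar)
    {y η : EuclideanSpace ℝ (Fin n)} (hη : ∀ z, P₂ y + inner ℝ η (z - y) ≤ P₂ z) :
    gradient P₁ y - η ∈ clarkeSubdiff (fun z => P₁ z - P₂ z) y :=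
  MBA.sub_mem_clarkeSubdiff (fun _ => rfl) (h.differentiable y).hasFDerivAt
    (fun _ => (inner_gradient_left ..).symm) hη

theorem exists_multiplier (h : IsBoundedRun P₁ P₂ ρ α lmin lmax L M x ζ lbar) (t : ℕ) :
    ∃ lam : ℝ, 0 ≤ lam ∧
      lam * ((P₁ (x t) - P₂ (x t)) + inner ℝ (gradient P₁ (x t) - ζ t) (x (t + 1) - x t)
        + lbar t / 2 * ‖x (t + 1) - x t‖ ^ 2) = 0 ∧
      ∀ y, l1norm (x (t + 1)) + inner ℝ ((ratio (x t) / ‖x t‖) • x t - α • (x (t + 1) - x t)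
        - lam • (gradient P₁ (x t) - ζ t + lbar t • (x (t + 1) - x t))) (y - x (t + 1))
          ≤ l1norm y :=
  (h.solves t).exists_multiplier (h.lbar_nonneg t) h.alpha_pos.le (h.feasible t)
    fun h0 h1 => h.gmfcq _ h0 (h1 ▸ h.sub_mem_clarkeSubdiff (h.subgradient t))

theorem subgradient_of_tendsto (h : IsBoundedRun P₁ P₂ ρ α lmin lmax L M x ζ lbar) {φ : ℕ → ℕ}
    {y η : EuclideanSpace ℝ (Fin n)} (hy : Tendsto (x ∘ φ) atTop (𝓝 y))
    (hη : Tendsto (ζ ∘ φ) atTop (𝓝 η)) (z : EuclideanSpace ℝ (Fin n)) :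
    P₂ y + inner ℝ η (z - y) ≤ P₂ z :=
  le_of_tendsto' (((h.continuous.tendsto y).comp hy).add (hη.inner (hy.const_sub z)))
    fun k => h.subgradient (φ k) z

theorem continuous_gradient (h : IsBoundedRun P₁ P₂ ρ α lmin lmax L M x ζ lbar) :
    Continuous (gradient P₁) := h.lipschitz.continuous

theorem tendsto_lbar_smul (h : IsBoundedRun P₁ P₂ ρ α lmin lmax L M x ζ lbar) :
    Tendsto (fun t => lbar t • (x (t + 1) - x t)) atTop (𝓝 0) := by
  rw [tendsto_zero_iff_norm_tendsto_zero]
  refine squeeze_zero (fun _ => norm_nonneg _) (fun t => ?_)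
    (by simpa using h.tendsto_norm_sub.const_mul (lmax + 4 * (L : ℝ)))
  rw [norm_smul, Real.norm_eq_abs, abs_of_nonneg (h.lbar_nonneg t)]
  exact mul_le_mul_of_nonneg_right (h.lbar_le t) (norm_nonneg _)

theorem tendsto_constraint (h : IsBoundedRun P₁ P₂ ρ α lmin lmax L M x ζ lbar) {φ : ℕ → ℕ}
    (hφ : Tendsto φ atTop atTop)
    {y η : EuclideanSpace ℝ (Fin n)} (hy : Tendsto (x ∘ φ) atTop (𝓝 y))
    (hη : Tendsto (ζ ∘ φ) atTop (𝓝 η)) :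
    Tendsto (fun k => (P₁ (x (φ k)) - P₂ (x (φ k)))
      + inner ℝ (gradient P₁ (x (φ k)) - ζ (φ k)) (x (φ k + 1) - x (φ k))
      + lbar (φ k) / 2 * ‖x (φ k + 1) - x (φ k)‖ ^ 2) atTop (𝓝 (P₁ y - P₂ y)) := by
  have hd : Tendsto (fun k => x (φ k + 1) - x (φ k)) atTop (𝓝 0) :=
    tendsto_zero_iff_norm_tendsto_zero.2 (h.tendsto_norm_sub.comp hφ)
  have hl := h.tendsto_lbar_smul.comp hφ
  have h1 := ((h.differentiable.continuous.tendsto y).comp hy).sub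
    ((h.continuous.tendsto y).comp hy)
  have h2 := (((h.continuous_gradient.tendsto y).comp hy).sub hη).inner (𝕜 := ℝ) hd
  have h3 := (hl.inner (𝕜 := ℝ) hd).const_mul (1 / 2)
  have := (h1.add h2).add h3
  simp only [inner_zero_right, mul_zero, add_zero] at this
  refine this.congr fun k => ?_
  simp only [Function.comp_apply, real_inner_smul_left, real_inner_self_eq_norm_sq]
  ring

/-- Along a subsequence with multipliers tending to infinity, complementarity makes the constraint
active in the limit, and division of the optimality condition by the multiplier gives `∇P₁ y = η`.
This contradicts the GMFCQ. -/
theorem exists_multiplier_bound (h : IsBoundedRun P₁ P₂ ρ α lmin lmax L M x ζ lbar)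
    {lam : ℕ → ℝ} (h0 : ∀ t, 0 ≤ lam t)
    (hcomp : ∀ t, lam t * ((P₁ (x t) - P₂ (x t))
        + inner ℝ (gradient P₁ (x t) - ζ t) (x (t + 1) - x t)
        + lbar t / 2 * ‖x (t + 1) - x t‖ ^ 2) = 0)
    (hs : ∀ t y, l1norm (x (t + 1)) + inner ℝ ((ratio (x t) / ‖x t‖) • x t
        - α • (x (t + 1) - x t)
        - lam t • (gradient P₁ (x t) - ζ t + lbar t • (x (t + 1) - x t))) (y - x (t + 1))
          ≤ l1norm y) : ∃ Λ, 0 ≤ Λ ∧ ∀ t, lam t ≤ Λ := by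
  suffices H : ∃ Λ, ∀ᶠ t in atTop, lam t ≤ Λ by
    obtain ⟨Λ, hΛ⟩ := H
    have hb : BddAbove (range lam) := by
      have : IsBoundedUnder (· ≤ ·) atTop lam := ⟨Λ, hΛ⟩
      exact this.bddAbove_range
    obtain ⟨B, hB⟩ := hb
    exact ⟨B, (h0 0).trans (hB ⟨0, rfl⟩), fun t => hB ⟨t, rfl⟩⟩
  by_contra! hcon
  obtain ⟨φ, hφ, hlt⟩ := extraction_forall_of_frequently fun k : ℕ =>
    hcon (k + 1)
  obtain ⟨B, hB⟩ := h.exists_zeta_bound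
  obtain ⟨⟨y, η⟩, -, ψ, hψ, hlim⟩ := tendsto_subseq_of_bounded
    ((Metric.isBounded_closedBall (x := (0 : EuclideanSpace ℝ (Fin n))) (r := M)).prod
      (Metric.isBounded_closedBall (x := (0 : EuclideanSpace ℝ (Fin n))) (r := B)))
    (x := fun k => (x (φ k), ζ (φ k)))
    (fun k => ⟨by simpa using h.norm_le _, by simpa using hB _⟩)
  set χ := φ ∘ ψ with hχ
  have hχt : Tendsto χ atTop atTop := (hφ.comp hψ).tendsto_atTop
  have hy : Tendsto (x ∘ χ) atTop (𝓝 y) := (continuous_fst.tendsto _).comp hlim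
  have hη : Tendsto (ζ ∘ χ) atTop (𝓝 η) := (continuous_snd.tendsto _).comp hlim
  have hlam : ∀ k : ℕ, (k : ℝ) + 1 < lam (χ k) := fun k => by
    refine lt_of_le_of_lt ?_ (hlt (ψ k))
    have : (k : ℝ) ≤ ψ k := by exact_mod_cast hψ.id_le k
    linarith
  have hsub := h.subgradient_of_tendsto hy hη
  have hq : P₁ y - P₂ y = 0 := by
    refine tendsto_nhds_unique (h.tendsto_constraint hχt hy hη) ?_
    refine tendsto_const_nhds.congr fun k => ?_
    have hpos : 0 < lam (χ k) := lt_trans (by positivity) (hlam k)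
    exact ((mul_eq_zero.1 (hcomp (χ k))).resolve_left hpos.ne').symm
  have hM := h.bound_pos
  have hg : gradient P₁ y - η = 0 := by
    have h1 : Tendsto (fun k => gradient P₁ (x (χ k)) - ζ (χ k)
        + lbar (χ k) • (x (χ k + 1) - x (χ k))) atTop (𝓝 (gradient P₁ y - η)) := by
      simpa using (((h.continuous_gradient.tendsto y).comp hy).sub hη).add
        (h.tendsto_lbar_smul.comp hχt)
    refine tendsto_nhds_unique h1 (tendsto_zero_iff_norm_tendsto_zero.2 ?_)
    refine squeeze_zero (fun _ => norm_nonneg _) (fun k => ?_)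
      (tendsto_const_div_atTop_nhds_zero_nat (2 * (n * (M + 1)) + n + α * (2 * M)) |>.comp
        (tendsto_add_atTop_nat 1))
    simp only [Function.comp_apply, Nat.cast_add, Nat.cast_one]
    set t := χ k with ht
    set G := gradient P₁ (x t) - ζ t + lbar t • (x (t + 1) - x t) with hG
    set s := (ratio (x t) / ‖x t‖) • x t - α • (x (t + 1) - x t) - lam t • G with hsdef
    have e1 : ‖s‖ ≤ 2 * (n * (M + 1)) := norm_subgradient_le (hs t) (R := M) (fun y hy => by
      rw [abs_of_nonneg (l1norm_nonneg y)]
      exact (l1norm_le y).trans (by gcongr)) (h.norm_le _)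
    have e2 : ‖(ratio (x t) / ‖x t‖) • x t‖ ≤ n := by
      rw [norm_smul, norm_div, norm_norm, Real.norm_eq_abs, abs_of_nonneg (ratio_nonneg _),
        div_mul_cancel₀ _ (norm_ne_zero_iff.2 (h.x_ne_zero t))]
      exact ratio_le _
    have e3 : ‖α • (x (t + 1) - x t)‖ ≤ α * (2 * M) := by
      rw [norm_smul, Real.norm_eq_abs, abs_of_pos h.alpha_pos]
      have := h.alpha_pos
      gcongr
      linarith [norm_sub_le (x (t + 1)) (x t), h.norm_le t, h.norm_le (t + 1)]
    have e4 : lam t * ‖G‖ ≤ 2 * (n * (M + 1)) + n + α * (2 * M) := by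
      have : lam t • G = (ratio (x t) / ‖x t‖) • x t - α • (x (t + 1) - x t) - s := by
        rw [hsdef]; abel
      calc lam t * ‖G‖ = ‖lam t • G‖ := by
            rw [norm_smul, Real.norm_eq_abs, abs_of_nonneg (h0 t)]
        _ ≤ ‖(ratio (x t) / ‖x t‖) • x t‖ + ‖α • (x (t + 1) - x t)‖ + ‖s‖ := by
            rw [this]; exact (norm_sub_le _ _).trans (by gcongr; exact norm_sub_le _ _)
        _ ≤ _ := by linarith
    rw [le_div_iff₀ (by positivity)]
    have := mul_le_mul_of_nonneg_left (hlam k).le (norm_nonneg G)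
    linarith
  exact h.gmfcq y hq (hg ▸ h.sub_mem_clarkeSubdiff hsub)

end IsBoundedRun

end Run

/-! ### Criticality of the limit, and KL data along the run. -/

namespace IsBoundedRun

variable {n : ℕ} {P₁ P₂ : EuclideanSpace ℝ (Fin n) → ℝ} {ρ α lmin lmax : ℝ} {L : NNReal}
    {M : ℝ} {x ζ : ℕ → EuclideanSpace ℝ (Fin n)} {lbar : ℕ → ℝ}

theorem exists_critical_multiplier (h : IsBoundedRun P₁ P₂ ρ α lmin lmax L M x ζ lbar)
    {y : EuclideanSpace ℝ (Fin n)} (hy : Tendsto x atTop (𝓝 y)) :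
    ∃ (μ : ℝ) (η : EuclideanSpace ℝ (Fin n)), 0 ≤ μ ∧ μ * (P₁ y - P₂ y) = 0 ∧
      (∀ z, P₂ y + inner ℝ η (z - y) ≤ P₂ z) ∧
      -(μ • (gradient P₁ y - η)) ∈ regularSubdiff (fun z => (ratio z : EReal)) y := by
  choose lam h0 hcomp hs using h.exists_multiplier
  obtain ⟨Λ, -, hΛ⟩ := h.exists_multiplier_bound h0 hcomp hs
  obtain ⟨B, hB⟩ := h.exists_zeta_bound
  obtain ⟨⟨η, μ⟩, -, φ, hφ, hlim⟩ := tendsto_subseq_of_bounded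
    ((Metric.isBounded_closedBall (x := (0 : EuclideanSpace ℝ (Fin n))) (r := B)).prod
      (Metric.isBounded_Icc (0 : ℝ) Λ))
    (x := fun k => (ζ k, lam k)) (fun k => ⟨by simpa using hB _, h0 k, hΛ k⟩)
  have hφt := hφ.tendsto_atTop
  have hη : Tendsto (ζ ∘ φ) atTop (𝓝 η) := (continuous_fst.tendsto _).comp hlim
  have hμ : Tendsto (lam ∘ φ) atTop (𝓝 μ) := (continuous_snd.tendsto _).comp hlim
  have hyφ := hy.comp hφt
  have hyφ' : Tendsto (fun k => x (φ k + 1)) atTop (𝓝 y) :=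
    hy.comp ((tendsto_add_atTop_nat 1).comp hφt)
  have hμ0 : 0 ≤ μ := ge_of_tendsto' hμ fun k => h0 _
  have hy0 : 0 < ‖y‖ := h.rho_pos.trans_le (ge_of_tendsto' hy.norm fun t => (h.lt_norm_x t).le)
  have hyne : y ≠ 0 := norm_pos_iff.1 hy0
  have hcon : μ * (P₁ y - P₂ y) = 0 := by
    refine tendsto_nhds_unique (hμ.mul (h.tendsto_constraint hφt hyφ hη)) ?_
    exact tendsto_const_nhds.congr fun k => (hcomp (φ k)).symm
  have hsub : ∀ z, l1norm y + inner ℝ ((ratio y / ‖y‖) • y - μ • (gradient P₁ y - η)) (z - y)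
      ≤ l1norm z := by
    intro z
    have hd : Tendsto (fun k => x (φ k + 1) - x (φ k)) atTop (𝓝 0) := by
      simpa using hyφ'.sub hyφ
    have e1 := ((((continuousAt_ratio hyne).tendsto.comp hyφ).div hyφ.norm hy0.ne').smul hyφ).sub
      (hd.const_smul α)
    have e2 := hμ.smul ((((h.continuous_gradient.tendsto y).comp hyφ).sub hη).add
      (h.tendsto_lbar_smul.comp hφt))
    have e3 := ((continuous_l1norm.tendsto y).comp hyφ').add
      ((e1.sub e2).inner (𝕜 := ℝ) (hyφ'.const_sub z))
    simp only [smul_zero, sub_zero, add_zero] at e3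
    exact le_of_tendsto' e3 fun k => hs (φ k) z
  -- The division by `‖y‖` converts the multiplier for the ℓ₁ subproblem into one for the ratio.
  refine ⟨μ / ‖y‖, η, by positivity, ?_, h.subgradient_of_tendsto hyφ hη, ?_⟩
  · rw [div_mul_eq_mul_div, hcon, zero_div]
  · convert mem_regularSubdiff_ratio hyne hsub using 1
    have e : l1norm y / ‖y‖ ^ 3 = ‖y‖⁻¹ * (ratio y / ‖y‖) := by unfold ratio; field_simp
    rw [e, div_eq_inv_mul μ]
    module

theorem isClarkeCritical (h : IsBoundedRun P₁ P₂ ρ α lmin lmax L M x ζ lbar)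
    {y : EuclideanSpace ℝ (Fin n)} (hy : Tendsto x atTop (𝓝 y)) :
    IsClarkeCritical (fun z => P₁ z - P₂ z) y := by
  obtain ⟨μ, η, hμ, hc, hη, hr⟩ := h.exists_critical_multiplier hy
  refine ⟨?_, μ, hμ, ?_, hc⟩
  · exact le_of_tendsto' (((h.differentiable.continuous.tendsto y).comp hy).sub
      ((h.continuous.tendsto y).comp hy)) h.feasible
  · refine mem_add.2 ⟨_, regularSubdiff_subset_limitingSubdiff _ _ hr, _,
      smul_mem_smul_set (h.sub_mem_clarkeSubdiff hη), by simp⟩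

theorem isStationary (h : IsBoundedRun P₁ P₂ ρ α lmin lmax L M x ζ lbar)
    {y : EuclideanSpace ℝ (Fin n)} (hy : Tendsto x atTop (𝓝 y))
    (hreg : IsRegularAt (fun z => P₁ z - P₂ z) y) : IsStationary (fun z => P₁ z - P₂ z) y := by
  obtain ⟨μ, η, hμ, hc, hη, hr⟩ := h.exists_critical_multiplier hy
  have hfeas := (h.isClarkeCritical hy).1
  have hlip : LocallyLipschitz fun z => P₁ z - P₂ z :=
    (h.contDiff.of_le (by norm_num)).locallyLipschitz.sub
      (locallyLipschitzOn_univ.1 (h.convexOn.locallyLipschitzOn isOpen_univ))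
  obtain ⟨v, hv⟩ := hreg.exists_mem_regularSubdiff hlip
  -- The regular subgradient of `q` is forced to be the vector occurring in the multiplier rule, so
  -- the two first-order inequalities can be added with weight `μ`.
  have hve : v = gradient P₁ y - η := eq_sub_of_mem_regularSubdiff (fun _ => rfl)
    (h.differentiable y).hasFDerivAt (fun _ => (inner_gradient_left ..).symm) hη hv
  refine ⟨hfeas, regularSubdiff_subset_limitingSubdiff _ _ ?_⟩
  rw [mem_regularSubdiff_iff (c := ratio y) (by
    have : y ∈ {z | P₁ z - P₂ z ≤ 0} := hfeas
    simp only [delta, if_pos this, add_zero])]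
  intro ε hε
  rw [← hve] at hr
  rw [mem_regularSubdiff_real_iff] at hr hv
  have hpos : 0 < ε / (1 + μ) := by positivity
  filter_upwards [hr _ hpos, hv _ hpos] with z h1 h2
  by_cases hz : z ∈ {z | P₁ z - P₂ z ≤ 0}
  · simp only [delta, if_pos hz, add_zero, EReal.coe_le_coe_iff]
    have hz' : P₁ z - P₂ z ≤ 0 := hz
    rw [inner_neg_left, real_inner_smul_left] at h1
    rw [inner_zero_left]
    have h3 := mul_le_mul_of_nonneg_left (h2.trans hz') hμ
    have h4 : ε * ‖z - y‖ = ε / (1 + μ) * ‖z - y‖ + μ * (ε / (1 + μ) * ‖z - y‖) := by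
      field_simp
    rw [h4]
    linarith
  · simp only [delta, if_neg hz, EReal.coe_add_top]
    exact le_top

theorem potential_lift (h : IsBoundedRun P₁ P₂ ρ α lmin lmax L M x ζ lbar) (t : ℕ) :
    potential P₁ P₂ ρ (lift (x (t + 1)) (x t) (ζ t) (lbar t)) = ratio (x (t + 1)) := by
  refine potential_eq_ratio (z := lift (x (t + 1)) (x t) (ζ t) (lbar t)) ?_ (h.lt_norm_x _).le
  change qLifted P₁ P₂ (x (t + 1)) (x t) (ζ t) (lbar t) ≤ 0
  rw [qLifted_eq (h.subgradient t)]
  exact_mod_cast (h.solves t).1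

theorem exists_subgradient_potential (h : IsBoundedRun P₁ P₂ ρ α lmin lmax L M x ζ lbar) :
    ∃ (V : ℕ → LiftedSpace n) (C : ℝ), 0 < C ∧ ∀ t,
      V t ∈ regularSubdiff (potential P₁ P₂ ρ) (lift (x (t + 1)) (x t) (ζ t) (lbar t)) ∧
      ‖V t‖ ≤ C * ‖x (t + 1) - x t‖ := by
  choose lam h0 hcomp hs using h.exists_multiplier
  obtain ⟨Λ, hΛ0, hΛ⟩ := h.exists_multiplier_bound h0 hcomp hs
  have hρ := h.rho_pos
  have hα := h.alpha_pos
  have hM := h.bound_pos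
  have hl : 0 ≤ lmax := h.lmin_pos.le.trans h.lmin_le
  have hL : (0 : ℝ) ≤ L := L.coe_nonneg
  -- The four summands bound the four blocks of the lifted subgradient. The multiplier is rescaled
  -- by `‖x (t + 1)‖` so that the constraint gradients cancel in the first block.
  refine ⟨_, ρ⁻¹ * (4 * n / ρ + α) + Λ / ρ * (L + (lmax + 4 * L)) + Λ / ρ + Λ / ρ * M,
    by positivity, fun t => ⟨lift_mem_regularSubdiff_potential h.contDiff hρ
      (lam := lam t / ‖x (t + 1)‖) (h.subgradient t)
      (h.solves t).1 (div_nonneg (h0 t) (norm_nonneg _))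
      (by rw [div_mul_eq_mul_div, hcomp, zero_div]) (h.lt_norm_x _).le (hs t), ?_⟩⟩
  set xn := x (t + 1) with hxn
  set d := ‖xn - x t‖ with hd
  have hd0 : 0 ≤ d := norm_nonneg _
  have hρn : ρ ≤ ‖xn‖ := (h.lt_norm_x _).le
  have hn0 : 0 < ‖xn‖ := hρ.trans_le hρn
  set μ := lam t / ‖xn‖ with hμ
  have hμ0 : 0 ≤ μ := div_nonneg (h0 t) (norm_nonneg _)
  have hμΛ : μ ≤ Λ / ρ := div_le_div₀ hΛ0 (hΛ t) hρ hρn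
  have hinv : ‖xn‖⁻¹ ≤ ρ⁻¹ := inv_anti₀ hρ hρn
  have hnsmul : ∀ v : EuclideanSpace ℝ (Fin n), ‖μ • v‖ = μ * ‖v‖ := fun v => by
    rw [norm_smul, Real.norm_eq_abs, abs_of_nonneg hμ0]
  refine (norm_lift_le _ _ _ _).trans ?_
  rw [add_mul, add_mul, add_mul]
  refine add_le_add (add_le_add (add_le_add ?_ ?_) ?_) ?_
  · have e : ‖xn‖⁻¹ • ((ratio (x t) / ‖x t‖) • x t - α • (xn - x t)
          - lam t • (gradient P₁ (x t) - ζ t + lbar t • (xn - x t)))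
        - (l1norm xn / ‖xn‖ ^ 3) • xn
        + μ • (gradient P₁ (x t) - ζ t + lbar t • (xn - x t)) =
        ‖xn‖⁻¹ • (((ratio (x t) / ‖x t‖) • x t - (ratio xn / ‖xn‖) • xn) - α • (xn - x t)) := by
      have e1 : l1norm xn / ‖xn‖ ^ 3 = ‖xn‖⁻¹ * (ratio xn / ‖xn‖) := by unfold ratio; field_simp
      rw [e1, hμ, div_eq_inv_mul (lam t)]
      module
    rw [e, norm_smul, norm_inv, norm_norm, mul_assoc]
    refine mul_le_mul hinv ?_ (norm_nonneg _) (by positivity)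
    refine (norm_sub_le _ _).trans ?_
    rw [add_mul, norm_smul, Real.norm_eq_abs, abs_of_pos hα]
    refine add_le_add ?_ le_rfl
    rw [hd, norm_sub_rev xn]
    exact norm_ratio_smul_sub_le hρ (h.lt_norm_x t).le (h.x_ne_zero _)
  · rw [hnsmul, mul_assoc]
    refine mul_le_mul hμΛ ((norm_sub_le _ _).trans ?_) (norm_nonneg _) (by positivity)
    rw [add_mul]
    refine add_le_add ?_ ?_
    · refine (ContinuousLinearMap.le_opNorm _ _).trans ?_
      rw [LinearIsometryEquiv.norm_map]
      exact mul_le_mul_of_nonneg_right (norm_fderiv_le_of_lipschitz ℝ h.lipschitz) hd0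
    · rw [norm_smul, Real.norm_eq_abs, abs_of_nonneg (h.lbar_nonneg t)]
      exact mul_le_mul_of_nonneg_right (h.lbar_le t) hd0
  · rw [hnsmul, norm_sub_rev]
    exact mul_le_mul_of_nonneg_right hμΛ hd0
  · rw [abs_of_nonneg (by positivity), mul_assoc]
    refine mul_le_mul hμΛ ?_ (by positivity) (by positivity)
    have : d ≤ 2 * M := (norm_sub_le _ _).trans (by linarith [h.norm_le t, h.norm_le (t + 1)])
    nlinarith

/-- Sufficient decrease and the KL inequality along the sequence. -/
theorem exists_KL_data (h : IsBoundedRun P₁ P₂ ρ α lmin lmax L M x ζ lbar)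
    (hpc : IsProperClosed (potential P₁ P₂ ρ)) (S : Set (ℝ → ℝ))
    (hS : ∀ φ ∈ S, ∀ ψ ∈ S, φ + ψ ∈ S)
    (hKL : ∀ z ∈ domSubdiff (potential P₁ P₂ ρ), ∃ (a : EReal), ∃ φ ∈ S, 0 < a ∧
      IsDesingularizing a φ ∧ KLInequality (potential P₁ P₂ ρ) z a φ) :
    ∃ (b : ℕ → ℝ) (c C : ℝ) (a : EReal), ∃ φ ∈ S, ∃ T : ℕ, 0 < c ∧ 0 < C ∧
      IsDesingularizing a φ ∧ (∀ t, 0 ≤ b t) ∧ Antitone b ∧ Tendsto b atTop (𝓝 0) ∧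
      (∀ t ≥ T, (b t : EReal) < a) ∧
      (∀ t, b (t + 1) + c * ‖x (t + 2) - x (t + 1)‖ ^ 2 ≤ b t) ∧
      (∀ t ≥ T, 0 < b t → 1 ≤ deriv φ (b t) * (C * ‖x (t + 1) - x t‖)) := by
  obtain ⟨ω, hω, hωle⟩ := h.exists_tendsto_ratio
  obtain ⟨V, C, hC, hV⟩ := h.exists_subgradient_potential
  obtain ⟨B, hB⟩ := h.exists_zeta_bound
  have hM := h.bound_pos
  have hα := h.alpha_pos
  set z : ℕ → LiftedSpace n := fun t => lift (x (t + 1)) (x t) (ζ t) (lbar t) with hz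
  have hr : Tendsto (fun t => ratio (x (t + 1))) atTop (𝓝 ω) :=
    hω.comp (tendsto_add_atTop_nat 1)
  have hV0 : Tendsto V atTop (𝓝 0) := by
    rw [tendsto_zero_iff_norm_tendsto_zero]
    exact squeeze_zero (fun _ => norm_nonneg _) (fun t => (hV t).2)
      (by simpa using h.tendsto_norm_sub.const_mul C)
  have hbdd : ∀ t, z t ∈ Metric.closedBall (0 : LiftedSpace n) (M + M + B + (lmax + 4 * L)) := by
    intro t
    rw [mem_closedBall_zero_iff]
    refine (norm_lift_le _ _ _ _).trans ?_
    rw [abs_of_nonneg (h.lbar_nonneg t)]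
    linarith [h.norm_le t, h.norm_le (t + 1), hB t, h.lbar_le t]
  have hcluster : ∀ y, MapClusterPt y atTop z → potential P₁ P₂ ρ y = ω ∧
      ∃ (a : EReal), ∃ φ ∈ S, 0 < a ∧ IsDesingularizing a φ ∧
        KLInequality (potential P₁ P₂ ρ) y a φ := by
    intro y hy
    obtain ⟨ψ, hψ, hlim⟩ := hy.tendsto_subseq
    have hrψ := hr.comp hψ.tendsto_atTop
    -- Lower semicontinuity excludes an infinite value at a cluster point, because the values along
    -- the sequence tend to `ω`.
    have hne : potential P₁ P₂ ρ y ≠ ⊤ := by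
      intro htop
      have h1 := hpc.2.2 y ((ω + 1 : ℝ) : EReal) (by
        change _ < potential P₁ P₂ ρ y
        rw [htop]; exact EReal.coe_lt_top _)
      obtain ⟨k, hk1, hk2⟩ := ((hlim.eventually h1).and
        (hrψ.eventually (gt_mem_nhds (lt_add_one ω)))).exists
      simp only [Function.comp_apply, hz, h.potential_lift, EReal.coe_lt_coe_iff] at hk1 hk2
      exact lt_asymm hk1 hk2
    obtain ⟨hy1, hy2⟩ := of_potential_ne_top hne
    have hyne : y.fst ≠ 0 := norm_pos_iff.1 (h.rho_pos.trans_le hy2)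
    have hval : potential P₁ P₂ ρ y = ω := by
      rw [potential_eq_ratio hy1 hy2, EReal.coe_eq_coe_iff]
      have hfst : Continuous fun w : LiftedSpace n => w.fst := by fun_prop
      exact tendsto_nhds_unique
        ((continuousAt_ratio hyne).tendsto.comp ((hfst.tendsto y).comp hlim)) hrψ
    -- Zero is a limiting subgradient at the cluster point: the vectors `V t` tend to zero and the
    -- function values converge, so the KL hypothesis applies there.
    refine ⟨hval, hKL y ⟨0, hne, hpc.1 y, z ∘ ψ, V ∘ ψ, hlim, ?_, fun k => (hV _).1,
      hV0.comp hψ.tendsto_atTop⟩⟩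
    rw [hval]
    refine ((EReal.tendsto_coe.2 hrψ)).congr fun k => ?_
    exact (h.potential_lift _).symm
  obtain ⟨a, φ, hφS, ha, hφ, hev⟩ := exists_uniform_KL (isCompact_closedBall _ _) hbdd
    h.potential_lift hr S hS hcluster
  have hb : Tendsto (fun t => ratio (x (t + 1)) - ω) atTop (𝓝 0) := by simpa using hr.sub_const ω
  have hba : ∀ᶠ t in atTop, ((ratio (x (t + 1)) - ω : ℝ) : EReal) < a :=
    (EReal.tendsto_coe.2 hb).eventually (gt_mem_nhds (by simpa using ha))
  obtain ⟨T, hT⟩ := eventually_atTop.1 (hev.and hba)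
  -- The gap is shifted by one because the first block of the lifted point at time `t` is `x (t +
  -- 1)`.
  refine ⟨fun t => ratio (x (t + 1)) - ω, α / (2 * M), C, a, φ, hφS, T, by positivity, hC, hφ,
    fun t => sub_nonneg.2 (hωle _), fun s t hst => ?_, hb, fun t ht => (hT t ht).2, fun t => ?_,
    fun t ht hpos => ?_⟩
  · exact sub_le_sub_right (h.antitone_ratio (by omega : s + 1 ≤ t + 1)) ω
  · have := h.descent (t + 1)
    simp only [show t + 1 + 1 = t + 2 by ring] at this ⊢
    linarith
  · have h1 := (hT t ht).1 (sub_pos.1 hpos)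
    have h2 : Metric.infEDist (0 : LiftedSpace n) (limitingSubdiff (potential P₁ P₂ ρ) (z t)) ≤
        ENNReal.ofReal ‖V t‖ := by
      refine (Metric.infEDist_le_edist_of_mem
        (regularSubdiff_subset_limitingSubdiff _ _ (hV t).1)).trans ?_
      rw [edist_dist, dist_zero_left]
    have hd := hφ.deriv_pos _ hpos (hT t ht).2
    have h3 := h1.trans (mul_le_mul_right h2 _)
    rw [← ENNReal.ofReal_mul hd.le, ← ENNReal.ofReal_one,
      ENNReal.ofReal_le_ofReal_iff (by positivity)] at h3
    exact h3.trans (mul_le_mul_of_nonneg_left (hV t).2 hd.le)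

theorem exists_tendsto (h : IsBoundedRun P₁ P₂ ρ α lmin lmax L M x ζ lbar)
    (hKL : IsKLFunction (potential P₁ P₂ ρ)) : ∃ xstar, Tendsto x atTop (𝓝 xstar) := by
  obtain ⟨b, c, C, a, φ, -, T, hc, hC, hφ, hb0, -, -, hba, hdec, hineq⟩ :=
    h.exists_KL_data hKL.1 univ (fun _ _ _ _ => mem_univ _) fun z hz => by
      obtain ⟨a, φ, ha, hφ, hineq⟩ := hKL.2 z hz
      exact ⟨a, φ, mem_univ _, ha, hφ, hineq⟩
  obtain ⟨xstar, hx, -⟩ := exists_limit_of_KL hc hC.le hφ hb0 hba hdec hineq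
  exact ⟨xstar, hx⟩

theorem rates (h : IsBoundedRun P₁ P₂ ρ α lmin lmax L M x ζ lbar) {θ : ℝ} (hθ1 : θ < 1)
    (hKL : IsKLFunctionWithExponent (potential P₁ P₂ ρ) θ) {xstar : EuclideanSpace ℝ (Fin n)}
    (hx : Tendsto x atTop (𝓝 xstar)) :
    (θ = 0 → ∃ T : ℕ, ∀ t ≥ T, x t = xstar) ∧
    (0 < θ → θ ≤ 1 / 2 → ∃ c₀ : ℝ, 0 < c₀ ∧ ∃ Q₁ : ℝ, 0 < Q₁ ∧ Q₁ < 1 ∧ ∃ T : ℕ, ∀ t > T,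
      ‖x t - xstar‖ ≤ c₀ * Q₁ ^ t) ∧
    (1 / 2 < θ → ∃ c₀ : ℝ, 0 < c₀ ∧ ∃ T : ℕ, ∀ t > T,
      ‖x t - xstar‖ ≤ c₀ * (t : ℝ) ^ (-((1 - θ) / (2 * θ - 1)))) := by
  obtain ⟨b, c, C, a, φ, ⟨a₀, ha₀, rfl⟩, T, hc, hC, hφ, hb0, hanti, hb, hba, hdec, hineq⟩ :=
    -- For a fixed exponent the power functions are closed under addition, so the merged
    -- desingularizing function keeps the exponent.
    h.exists_KL_data hKL.1 {φ | ∃ a₀ : ℝ, 0 < a₀ ∧ φ = fun ν : ℝ => a₀ * ν ^ (1 - θ)}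
      (by
        rintro _ ⟨p, hp, rfl⟩ _ ⟨r, hr, rfl⟩
        exact ⟨p + r, by positivity, by ext ν; simp [add_mul]⟩)
      fun z hz => by
        obtain ⟨a, a₀, ha, ha₀, hφ, hineq⟩ := hKL.2 z hz
        exact ⟨a, _, ⟨a₀, ha₀, rfl⟩, ha, hφ, hineq⟩
  obtain ⟨y, hy, hbd⟩ := exists_limit_of_KL hc hC.le hφ hb0 hba hdec hineq
  obtain rfl := tendsto_nhds_unique hx hy
  have hA : 0 < a₀ * (1 - θ) * C := mul_pos (mul_pos ha₀ (by linarith)) hC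
  have hB : 0 ≤ C / c * a₀ := by positivity
  have hineq' : ∀ t ≥ T, 0 < b t → 1 ≤ a₀ * (1 - θ) * C * b t ^ (-θ) * ‖x (t + 1) - x t‖ := by
    intro t ht hpos
    have h1 := hineq t ht hpos
    have h2 : deriv (fun ν : ℝ => a₀ * ν ^ (1 - θ)) (b t) = a₀ * ((1 - θ) * b t ^ (-θ)) := by
      have := (Real.hasDerivAt_rpow_const (x := b t) (p := 1 - θ) (Or.inl hpos.ne')).const_mul a₀
      rw [this.deriv]; congr 3; ring
    rw [h2] at h1
    calc (1 : ℝ) ≤ _ := h1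
      _ = _ := by ring
  have hbd' : ∀ t ≥ T, ‖x (t + 1) - xstar‖ ≤ ‖x (t + 1) - x t‖ + C / c * a₀ * b t ^ (1 - θ) :=
    fun t ht => by rw [mul_assoc (C / c)]; exact hbd t ht
  refine ⟨fun hθ => ?_, fun hθ hθ2 => linear_rate hA hB hc hθ hθ2 hb0 hb hdec hbd' hineq',
    fun hθ => sublinear_rate hA hB hc hθ hθ1 hb0 hb hdec hbd' hineq'⟩
  subst hθ
  refine eventually_eq_of_exponent_zero hx hb0 hanti (fun t ht => ?_)
    (fun t ht => by simpa using hbd' t ht) (fun t ht hpos => by simpa using hineq' t ht hpos)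
  have h1 := hdec t
  have h2 := hb0 (t + 1)
  by_contra hne
  have h3 : 0 < ‖x (t + 2) - x (t + 1)‖ := norm_pos_iff.2 (sub_ne_zero.2 hne)
  have : 0 < c * ‖x (t + 2) - x (t + 1)‖ ^ 2 := by positivity
  linarith

end IsBoundedRun

end MBA

theorem mainTheorem5 {n : ℕ}
    (P₁ P₂ q : EuclideanSpace ℝ (Fin n) → ℝ)
    (hP₁ : ContDiff ℝ 2 P₁)
    (hP₁_lip : ∃ L : NNReal, LipschitzWith L (gradient P₁))
    (hP₂ : ConvexOn ℝ Set.univ P₂) (hP₂_cont : Continuous P₂)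
    (hq : ∀ x, q x = P₁ x - P₂ x)
    (hq0 : 0 < q 0)
    (hGMFCQ : ∀ x, q x ≤ 0 → MBA.GMFCQ q x)
    (ρ : ℝ) (hρ : 0 < ρ)
    (hρq : {x : EuclideanSpace ℝ (Fin n) | q x ≤ 0} ⊆ {x | ρ < ‖x‖})
    (α lmin lmax : ℝ) (hα : 0 < α) (hlmin : 0 < lmin) (hlmax : lmin < lmax)
    (x ζ : ℕ → EuclideanSpace ℝ (Fin n)) (lbar : ℕ → ℝ)
    (hx : MBA.IsMBASequence P₁ P₂ α lmin lmax x ζ lbar)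
    (hx_bdd : Bornology.IsBounded (Set.range x))
    (hKL : MBA.IsKLFunction (MBA.potential P₁ P₂ ρ)) :
    ∃ xstar : EuclideanSpace ℝ (Fin n),
      Tendsto x atTop (𝓝 xstar) ∧
      MBA.IsClarkeCritical q xstar ∧
      (MBA.IsRegularAt q xstar → MBA.IsStationary q xstar) ∧
      ∀ θ : ℝ, 0 ≤ θ → θ < 1 →
        MBA.IsKLFunctionWithExponent (MBA.potential P₁ P₂ ρ) θ →
        (θ = 0 → ∃ T : ℕ, ∀ t ≥ T, x t = xstar) ∧
        (0 < θ → θ ≤ 1 / 2 →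
          ∃ c₀ : ℝ, 0 < c₀ ∧ ∃ Q₁ : ℝ, 0 < Q₁ ∧ Q₁ < 1 ∧ ∃ T : ℕ, ∀ t > T,
            ‖x t - xstar‖ ≤ c₀ * Q₁ ^ t) ∧
        (1 / 2 < θ →
          ∃ c₀ : ℝ, 0 < c₀ ∧ ∃ T : ℕ, ∀ t > T,
            ‖x t - xstar‖ ≤ c₀ * (t : ℝ) ^ (-((1 - θ) / (2 * θ - 1)))) := by
  obtain ⟨L, hL⟩ := hP₁_lip
  obtain ⟨M, hM⟩ := hx_bdd.exists_norm_le
  obtain rfl : q = fun z => P₁ z - P₂ z := funext hq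
  have h : MBA.IsBoundedRun P₁ P₂ ρ α lmin lmax L M x ζ lbar :=
    { contDiff := hP₁
      lipschitz := hL
      convexOn := hP₂
      continuous := hP₂_cont
      rho_pos := hρ
      lt_norm := fun y hy => hρq hy
      gmfcq := fun y hy => hGMFCQ y hy.le hy
      alpha_pos := hα
      lmin_pos := hlmin
      lmin_le := hlmax.le
      run := hx
      norm_le := fun t => hM _ (Set.mem_range_self t) }
  obtain ⟨xstar, hlim⟩ := h.exists_tendsto hKL
  exact ⟨xstar, hlim, h.isClarkeCritical hlim, h.isStationary hlim,
    fun θ _ hθ1 hθ => h.rates hθ1 hθ hlim⟩
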